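/- **Theorem (Cut-free surjectivity).** The translation from cut-free proofs of unit-free first-order multiplicative linear logic to cut-free unification nets is surjective: if $\theta$ is a cut-free unification net on a clean sequent $\Gamma$, then there is a cut-free sequent proof $\Pi$ of $\Gamma$ whose translation is exactly $\theta$. The notions are as follows. *Formulas* are built from atoms $Pt_1\ldots t_n$ (with predicate symbols carrying an arity-preserving, fixed-point-free involution $P\mapsto\overline P$, and terms over an infinite set of variables) by tensor $\otimes$, par $\wp$, $\forall x$, $\exists x$. A *sequent* is a finite disjoint union of formulas, regarded as a forest of parse trees with edges directed towards the roots. It is *clean* if its quantified variables are distinct from each other and from its free variables; this can always be achieved by renaming bound variables. A universal (existential) variable of a clean sequent is one that is bound by a universal (existential) quantifier; a quantifier is *vacuous* if it binds no variable occurrence. *Cut-free proofs* are generated by the rules: axiom $Pt_1\ldots t_n,\ \overline P t_1\ldots t_n$; from $\Gamma,A,B$ infer $\Gamma,A \wp B$; from $\Gamma,A$ and $B,\Delta$ infer $\Gamma,A\otimes B,\Delta$; from $\Gamma,A[x\mapsto t]$ infer $\Gamma,\exists x A$ (no variable of $t$ being captured in the substitution); from $\Gamma,A$ infer $\Gamma,\forall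 x A$, if $x$ is not free in $\Gamma$. The *translation* of a cut-free proof is the set of pairs of leaves of its conclusion obtained by tracking the two atoms of each axiom down the proof. A *link* on $\Gamma$ is a pair of leaves with dual predicate symbols; a *linking* is a set of disjoint links whose union contains every leaf of $\Gamma$. A *unifier* of a linking is an assignment of terms to the non-vacuous existential variables which equalizes the term sequences at the two ends of each link; the *most general unifier* (mgu) is a unifier from which every unifier is obtained by a substitution that leaves fixed the free and the universal variables of $\Gamma$ (it is unique up to renaming, which is immaterial below). The *graph* of a unifiable linking is the directed forest $\Gamma$ together with an undirected edge for every link, and a directed edge, called a *leap*, from $\exists x$ to $\forall y$ whenever the mgu assigns to $x$ a term containing $y$. A *switching* is obtained by deleting all but one edge into each $ \wp $ and each $\forall$, and undirecting the remaining edges. A linking is *correct* if it is unifiable and all its switchings are trees (acyclic and connected). A *cut-free unification net* on $\Gamma$ is a correct linking on $\Gamma$. -/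

import Mathlib

universe u v w

namespace UNet

/-- An arity-preserving duality on the predicate symbols of the language `L`:
an involution without fixed points. -/
structure Duality (L : FirstOrder.Language.{u, v}) where
  neg : ∀ {n : ℕ}, L.Relations n → L.Relations n
  neg_neg : ∀ {n : ℕ} (P : L.Relations n), neg (neg P) = P
  neg_ne : ∀ {n : ℕ} (P : L.Relations n), neg P ≠ P

/-- Formulas of unit-free first-order multiplicative linear logic, with predicate symbols
`L.Relations`, function symbols `L.Functions` and term variables `V`. -/
inductive Formula (L : FirstOrder.Language.{u, v}) (V : Type w) : Type (max u v w)
  | atom {n : ℕ} (P : L.Relations n) (ts : Fin n → L.Term V) : Formula L V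
  | tensor (A B : Formula L V) : Formula L V
  | par (A B : Formula L V) : Formula L V
  | all (x : V) (A : Formula L V) : Formula L V
  | ex (x : V) (A : Formula L V) : Formula L V

/-- Directions from a vertex of a parse tree to its children: the two arguments of a binary
connective, or the body of a quantifier. -/
inductive Dir
  | left
  | right
  | body

section Formulas

variable {L : FirstOrder.Language.{u, v}} {V : Type w}

/-- The subformula at an address (a path starting from the root), if there is one. The vertices
of the parse tree of `A` are the addresses `p` with `A.sub? p ≠ none`. -/
def Formula.sub? : Formula L V → List Dir → Option (Formula L V)
  | A, [] => some A
  | .tensor A _, .left :: p => A.sub? p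
  | .tensor _ B, .right :: p => B.sub? p
  | .par A _, .left :: p => A.sub? p
  | .par _ B, .right :: p => B.sub? p
  | .all _ A, .body :: p => A.sub? p
  | .ex _ A, .body :: p => A.sub? p
  | _, _ :: _ => none

variable [DecidableEq V]

/-- The set of free variables. -/
def Formula.fv : Formula L V → Set V
  | .atom _ ts => {x | ∃ i, x ∈ (ts i).varFinset}
  | .tensor A B => A.fv ∪ B.fv
  | .par A B => A.fv ∪ B.fv
  | .all x A => A.fv \ {x}
  | .ex x A => A.fv \ {x}

/-- `A.subst x t`: replace all free occurrences of `x` in `A` by `t`. -/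
def Formula.subst (x : V) (t : L.Term V) : Formula L V → Formula L V
  | .atom P ts => .atom P fun i => (ts i).subst (Function.update FirstOrder.Language.Term.var x t)
  | .tensor A B => .tensor (A.subst x t) (B.subst x t)
  | .par A B => .par (A.subst x t) (B.subst x t)
  | .all y A => .all y (if y = x then A else A.subst x t)
  | .ex y A => .ex y (if y = x then A else A.subst x t)

/-- `A.FreeFor x t`: no variable of `t` is captured by a quantifier of `A` when `t` is substituted
for the free occurrences of `x` in `A`. -/
def Formula.FreeFor (x : V) (t : L.Term V) : Formula L V → Prop
  | .atom _ _ => True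
  | .tensor A B => A.FreeFor x t ∧ B.FreeFor x t
  | .par A B => A.FreeFor x t ∧ B.FreeFor x t
  | .all y A => x ∉ (Formula.all y A).fv ∨ (y ∉ t.varFinset ∧ A.FreeFor x t)
  | .ex y A => x ∉ (Formula.ex y A).fv ∨ (y ∉ t.varFinset ∧ A.FreeFor x t)

end Formulas

/-- A sequent is a disjoint union of formulas, that is, a family `Γ : ι → Formula L V` over a
finite type `ι`. It is regarded as a forest; its vertices are pairs of an index and an address. -/
abbrev Sequent (L : FirstOrder.Language.{u, v}) (V : Type w) (ι : Type) : Type (max u v w) :=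
  ι → Formula L V

/-- Potential vertices of a sequent with index type `ι`. -/
abbrev Pos (ι : Type) : Type := ι × List Dir

/-! ### Sequents as forests, clean sequents -/

section Forest

variable {L : FirstOrder.Language.{u, v}} {V : Type w} {ι : Type}

/-- The subformula of `Γ` whose root is the vertex `a`. -/
def Sequent.at? (Γ : Sequent L V ι) (a : Pos ι) : Option (Formula L V) :=
  (Γ a.1).sub? a.2

def Sequent.IsVertex (Γ : Sequent L V ι) (a : Pos ι) : Prop :=
  ∃ A, Γ.at? a = some A

def Sequent.IsLeaf (Γ : Sequent L V ι) (a : Pos ι) : Prop :=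
  ∃ (n : ℕ) (P : L.Relations n) (ts : Fin n → L.Term V), Γ.at? a = some (.atom P ts)

/-- The vertex `a` is a quantifier binding the variable `x`. -/
def Sequent.Quantifies (Γ : Sequent L V ι) (a : Pos ι) (x : V) : Prop :=
  ∃ A, Γ.at? a = some (.all x A) ∨ Γ.at? a = some (.ex x A)

def Sequent.IsUniversal (Γ : Sequent L V ι) (y : V) : Prop :=
  ∃ a A, Γ.at? a = some (.all y A)

variable [DecidableEq V]

/-- `x` occurs free in `Γ`. -/
def Sequent.IsFree (Γ : Sequent L V ι) (x : V) : Prop :=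
  ∃ i, x ∈ (Γ i).fv

/-- `x` is bound by a non-vacuous existential quantifier of `Γ`. -/
def Sequent.IsNonvacuousExistential (Γ : Sequent L V ι) (x : V) : Prop :=
  ∃ a A, Γ.at? a = some (.ex x A) ∧ x ∈ A.fv

/-- All quantified variables are distinct from each other and from all free variables. -/
def Sequent.Clean (Γ : Sequent L V ι) : Prop :=
  (∀ a b x, Γ.Quantifies a x → Γ.Quantifies b x → a = b) ∧
  (∀ a x, Γ.Quantifies a x → ¬ Γ.IsFree x)

end Forest

/-! ### Cut-free proofs and their translation to linkings -/

section Proofs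

variable {L : FirstOrder.Language.{u, v}} {V : Type w}

/-- The sequent `Γ, A`; the formula `A` has index `none`. -/
def Sequent.snoc {ι : Type} (Γ : Sequent L V ι) (A : Formula L V) : Sequent L V (Option ι)
  | none => A
  | some i => Γ i

/-- Cut-free sequent proofs. A sequent is an unordered disjoint union of formulas: the last
constructor says that only the formulas count, not the type that indexes them. -/
inductive CutFreeProof [DecidableEq V] (D : Duality L) :
    {ι : Type} → Sequent L V ι → Type (max 1 u v w)
  | ax {n : ℕ} (P : L.Relations n) (ts : Fin n → L.Term V) :
      CutFreeProof D ![.atom P ts, .atom (D.neg P) ts]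
  | par {ι : Type} {Γ : Sequent L V ι} {A B : Formula L V} :
      CutFreeProof D ((Γ.snoc A).snoc B) → CutFreeProof D (Γ.snoc (.par A B))
  | tensor {ι κ : Type} {Γ : Sequent L V ι} {Δ : Sequent L V κ} {A B : Formula L V} :
      CutFreeProof D (Γ.snoc A) → CutFreeProof D (Δ.snoc B) →
      CutFreeProof D (Sequent.snoc (Sum.elim Γ Δ) (.tensor A B))
  | ex {ι : Type} {Γ : Sequent L V ι} {A : Formula L V} (x : V) (t : L.Term V) :
      A.FreeFor x t → CutFreeProof D (Γ.snoc (A.subst x t)) → CutFreeProof D (Γ.snoc (.ex x A))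
  | all {ι : Type} {Γ : Sequent L V ι} {A : Formula L V} (x : V) :
      ¬ Γ.IsFree x → CutFreeProof D (Γ.snoc A) → CutFreeProof D (Γ.snoc (.all x A))
  | reindex {ι κ : Type} {Γ : Sequent L V κ} (e : ι ≃ κ) :
      CutFreeProof D (fun i => Γ (e i)) → CutFreeProof D Γ

/-- Tracking of vertices down a par rule. -/
def trackPar {ι : Type} : Pos (Option (Option ι)) → Pos (Option ι)
  | (none, p) => (none, .right :: p)
  | (some none, p) => (none, .left :: p)
  | (some (some i), p) => (some i, p)

/-- Tracking of vertices down a tensor rule, from its left hypothesis. -/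
def trackTensorLeft {ι : Type} (κ : Type) : Pos (Option ι) → Pos (Option (ι ⊕ κ))
  | (none, p) => (none, .left :: p)
  | (some i, p) => (some (.inl i), p)

/-- Tracking of vertices down a tensor rule, from its right hypothesis. -/
def trackTensorRight (ι : Type) {κ : Type} : Pos (Option κ) → Pos (Option (ι ⊕ κ))
  | (none, p) => (none, .right :: p)
  | (some j, p) => (some (.inr j), p)

/-- Tracking of vertices down a quantifier rule. -/
def trackQuantifier {ι : Type} : Pos (Option ι) → Pos (Option ι)
  | (none, p) => (none, .body :: p)
  | (some i, p) => (some i, p)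

/-- The translation of a cut-free proof: the set of pairs of leaves of its conclusion to which the
pairs of dual atoms of the axioms track. -/
def CutFreeProof.translate [DecidableEq V] {D : Duality L} :
    {ι : Type} → {Γ : Sequent L V ι} → CutFreeProof D Γ → Set (Sym2 (Pos ι))
  | _, _, .ax _ _ => {s((0, []), (1, []))}
  | _, _, .par π => Sym2.map trackPar '' π.translate
  | _, _, .tensor (ι := ι) (κ := κ) π π' =>
      Sym2.map (trackTensorLeft κ) '' π.translate ∪ Sym2.map (trackTensorRight ι) '' π'.translate
  | _, _, .ex _ _ _ π => Sym2.map trackQuantifier '' π.translate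
  | _, _, .all _ _ π => Sym2.map trackQuantifier '' π.translate
  | _, _, .reindex e π => Sym2.map (fun a => (e a.1, a.2)) '' π.translate

end Proofs

/-! ### Linkings, unifiers, precedences -/

section Nets

variable {L : FirstOrder.Language.{u, v}} {V : Type w} {ι : Type}

/-- `s` is a pair of leaves of `Γ` whose predicate symbols are dual. -/
def IsLink (D : Duality L) (Γ : Sequent L V ι) (s : Sym2 (Pos ι)) : Prop :=
  ∃ (a b : Pos ι) (n : ℕ) (P : L.Relations n) (ts ts' : Fin n → L.Term V),
    s = s(a, b) ∧ Γ.at? a = some (.atom P ts) ∧ Γ.at? b = some (.atom (D.neg P) ts')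

/-- A linking on `Γ`: a set of disjoint links whose union contains every leaf. -/
def IsLinking (D : Duality L) (Γ : Sequent L V ι) (θ : Set (Sym2 (Pos ι))) : Prop :=
  (∀ s ∈ θ, IsLink D Γ s) ∧
  (∀ s ∈ θ, ∀ s' ∈ θ, ∀ a, a ∈ s → a ∈ s' → s = s') ∧
  (∀ a, Γ.IsLeaf a → ∃ s ∈ θ, a ∈ s)

variable [DecidableEq V]

/-- A unifier: an assignment of terms to the non-vacuous existential variables (extended by the
identity to the other variables) that equalizes the term sequences at the two ends of each link. -/
def IsUnifier (Γ : Sequent L V ι) (θ : Set (Sym2 (Pos ι))) (σ : V → L.Term V) : Prop :=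
  (∀ x, ¬ Γ.IsNonvacuousExistential x → σ x = .var x) ∧
  ∀ (a b : Pos ι) (n : ℕ) (P P' : L.Relations n) (ts ts' : Fin n → L.Term V),
    s(a, b) ∈ θ → Γ.at? a = some (.atom P ts) → Γ.at? b = some (.atom P' ts') →
    ∀ i, (ts i).subst σ = (ts' i).subst σ

/-- A most general unifier: a unifier from which every unifier arises by a substitution. The free
and the universal variables of `Γ` are constants of the unification problem, so that the
substitution has to leave them alone. -/
def IsMGU (Γ : Sequent L V ι) (θ : Set (Sym2 (Pos ι))) (σ : V → L.Term V) : Prop :=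
  IsUnifier Γ θ σ ∧
  ∀ τ, IsUnifier Γ θ τ → ∃ ρ : V → L.Term V,
    (∀ y, Γ.IsFree y ∨ Γ.IsUniversal y → ρ y = .var y) ∧
    ∀ x, Γ.IsNonvacuousExistential x → τ x = (σ x).subst ρ

/-- The vertex `a` is an existential quantifier `∃ x`, the vertex `b` is a universal quantifier
`∀ y`, and the most general unifier assigns to `x` a term containing `y`. (Most general unifiers
differ only by a renaming that leaves `y` alone, so that it does not matter which one is used.) -/
def Precedence (Γ : Sequent L V ι) (θ : Set (Sym2 (Pos ι))) (a b : Pos ι) : Prop :=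
  ∃ x A y B, Γ.at? a = some (.ex x A) ∧ x ∈ A.fv ∧ Γ.at? b = some (.all y B) ∧
    ∃ σ, IsMGU Γ θ σ ∧ y ∈ (σ x).varFinset

/-! ### Graphs, switchings, correctness -/

/-- Potential edges of the graph of a linking: `child c p` is a directed edge from `c` to `p`,
`link s` is an undirected edge between the elements of `s`, and `leap a b` is a directed edge
from `a` to `b`. -/
inductive Edge (ι : Type)
  | child (c p : Pos ι)
  | link (s : Sym2 (Pos ι))
  | leap (a b : Pos ι)

/-- The pair of end points of an edge. -/
def Edge.ends : Edge ι → Sym2 (Pos ι)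
  | .child c p => s(c, p)
  | .link s => s
  | .leap a b => s(a, b)

/-- The edge is directed into the vertex `a`. -/
def Edge.Into : Edge ι → Pos ι → Prop
  | .child _ p, a => p = a
  | .link _, _ => False
  | .leap _ b, a => b = a

/-- The edges of the graph of the linking `θ` on `Γ`: the edges of the forest `Γ`, from each vertex
to its parent, the links, and the leaps. -/
def graphEdges (Γ : Sequent L V ι) (θ : Set (Sym2 (Pos ι))) : Set (Edge ι) :=
  {e | match e with
    | .child c p => Γ.IsVertex c ∧ ∃ d, c = (p.1, p.2 ++ [d])
    | .link s => s ∈ θ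
    | .leap a b => Precedence Γ θ a b}

/-- The vertex `a` is a par or a universal quantifier. -/
def Sequent.IsSwitched (Γ : Sequent L V ι) (a : Pos ι) : Prop :=
  (∃ A B, Γ.at? a = some (.par A B)) ∨ (∃ y A, Γ.at? a = some (.all y A))

/-- `S` is the set of edges of a switching: all but one edge into each par and each universal
quantifier have been deleted from the graph, and no other edges. -/
def IsSwitching (Γ : Sequent L V ι) (θ : Set (Sym2 (Pos ι))) (S : Set (Edge ι)) : Prop :=
  S ⊆ graphEdges Γ θ ∧
  (∀ e ∈ graphEdges Γ θ, (∀ a, Γ.IsSwitched a → ¬ e.Into a) → e ∈ S) ∧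
  (∀ a, Γ.IsSwitched a → ∃! e, e ∈ S ∧ e.Into a)

/-- The undirected simple graph on the vertices of `Γ` given by a set of edges. -/
def underlyingGraph (Γ : Sequent L V ι) (S : Set (Edge ι)) :
    SimpleGraph {a : Pos ι // Γ.IsVertex a} where
  Adj a b := a ≠ b ∧ ∃ e ∈ S, e.ends = s(a.1, b.1)
  symm := ⟨fun a b h => ⟨h.1.symm, by
    obtain ⟨e, he, h'⟩ := h.2
    exact ⟨e, he, h'.trans Sym2.eq_swap⟩⟩⟩
  loopless := ⟨fun _ h => h.1 rfl⟩

/-- The undirected multigraph on the vertices of `Γ` with edges `S` is a tree: no loops, no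
parallel edges (these would be cycles of length one and two), and the underlying simple graph
is connected and acyclic. -/
def IsTreeOn (Γ : Sequent L V ι) (S : Set (Edge ι)) : Prop :=
  (∀ e ∈ S, ¬ e.ends.IsDiag) ∧ Set.InjOn Edge.ends S ∧ (underlyingGraph Γ S).IsTree

/-- A linking is correct if it is unifiable and all of its switchings are trees. -/
def IsCorrect (Γ : Sequent L V ι) (θ : Set (Sym2 (Pos ι))) : Prop :=
  (∃ σ, IsUnifier Γ θ σ) ∧ ∀ S, IsSwitching Γ θ S → IsTreeOn Γ S

/-- `θ` is a cut-free unification net on the (clean) sequent `Γ`: a correct linking. -/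
def IsUnificationNet (D : Duality L) (Γ : Sequent L V ι) (θ : Set (Sym2 (Pos ι))) : Prop :=
  IsLinking D Γ θ ∧ IsCorrect Γ θ

end Nets

end UNet

namespace UNet

open FirstOrder FirstOrder.Language

/-! ### Substitution in terms -/

section Terms

variable {L : FirstOrder.Language.{u, v}} {V : Type w}

/-! The net is sequentialized from its conclusion upwards, with one solution `σ` of the unification
problem fixed throughout. It is a most general unifier (`exists_mgu`) in which the leftover
variables are replaced by a variable bound nowhere in `Γ`; its terms then contain no existential
variable, and all its leaps are leaps of the net (`IsUnificationNet.exists_isNet`). The induction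
runs over `IsNet`, where a variable whose quantifier has been removed becomes free but remains
subject to `σ`. It yields a proof of `Γ.msubst σ` (`IsNet.exists_proof`), which is `Γ` itself at the
start, and no unifier has to be recomputed for the smaller sequents.

The crux is to find a last rule (`IsNet.exists_removable`). A par or `∀` at a root can always be
removed, an `∃` if no leap leaves it, a tensor if an edge into it is a bridge of the whole graph,
with nothing deleted. Their existence is pure graph theory. Correctness says that for every choice
of one edge into each switched vertex the graph is connected and its directed edges are bridges. A
bridge whose source side has the fewest switched vertices leads to a switched vertex all of whose
sources lie in one component of the unswitched edges (`exists_contractible`). Making its edge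
permanent lowers the number of switched vertices, and induction gives a set `W` from which no edge
leads into a switched vertex, and whose switched vertices `p` each carry a private part `X p` of the
remaining graph (`exists_bottom`). Such a `W` contains a root. An `∃` there emits no leap, and a
tensor there is split by a bridge of one switching, cut down to `W`, with the parts `X p` carried
along. If only linked atoms are met, connectedness leaves nothing but an axiom.

The premises of the rule embed into the old forest, and what lies outside each image is attached to
it at a single vertex. Choices therefore extend to the old graph and its cuts restrict to the
premises, so these are correct again (`IsForestEmb.isCorrectFor`). -/

theorem subst_subst (t : L.Term V) (f g : V → L.Term V) :
    (t.subst f).subst g = t.subst fun x => (f x).subst g := by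
  induction t with
  | var => rfl
  | func _ _ ih => simp [Term.subst, ih]

theorem subst_var (t : L.Term V) : t.subst Term.var = t := by
  induction t with
  | var => rfl
  | func _ _ ih => simp [Term.subst, ih]

variable [DecidableEq V]

theorem subst_congr {t : L.Term V} {f g : V → L.Term V}
    (h : ∀ x ∈ t.varFinset, f x = g x) : t.subst f = t.subst g := by
  induction t with
  | var => exact h _ (by simp)
  | func F ts ih =>
    simp only [Term.subst]
    congr 1
    funext i
    exact ih i fun x hx => h x (by simpa using ⟨i, hx⟩)

theorem subst_eq_self {t : L.Term V} {f : V → L.Term V}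
    (h : ∀ x ∈ t.varFinset, f x = .var x) : t.subst f = t :=
  (subst_congr h).trans (subst_var t)

theorem mem_varFinset_subst {t : L.Term V} {f : V → L.Term V} {y : V} :
    y ∈ (t.subst f).varFinset ↔ ∃ x ∈ t.varFinset, y ∈ (f x).varFinset := by
  induction t with
  | var => simp [Term.subst]
  | func F ts ih =>
    simp only [Term.subst, Term.varFinset, Finset.mem_biUnion, Finset.mem_univ, true_and, ih]
    tauto

/-- The number of function symbols in a term. -/
def termSize : L.Term V → ℕ
  | .var _ => 0
  | .func _ ts => 1 + ∑ i, termSize (ts i)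

omit [DecidableEq V] in
theorem termSize_le_of_func {n : ℕ} (F : L.Functions n) (ts : Fin n → L.Term V) (i : Fin n) :
    termSize (ts i) < termSize (.func F ts) := by
  have := Finset.single_le_sum (f := fun j => termSize (ts j)) (fun _ _ => Nat.zero_le _)
    (Finset.mem_univ i)
  simp only [termSize]
  omega

theorem termSize_le_subst {t : L.Term V} {x : V} (τ : V → L.Term V) (h : x ∈ t.varFinset) :
    termSize (τ x) ≤ termSize (t.subst τ) := by
  induction t with
  | var y =>
    obtain rfl : x = y := by simpa using h
    exact le_rfl
  | func F ts ih =>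
    obtain ⟨i, hi⟩ : ∃ i, x ∈ (ts i).varFinset := by simpa using h
    exact (ih i hi).trans (termSize_le_of_func F (fun j => (ts j).subst τ) i).le

/-- The occurs check. -/
theorem eq_var_of_unifier {t : L.Term V} {x : V} {τ : V → L.Term V} (h : x ∈ t.varFinset)
    (e : τ x = t.subst τ) : t = .var x := by
  cases t with
  | var y =>
    obtain rfl : x = y := by simpa using h
    rfl
  | func F ts =>
    obtain ⟨i, hi⟩ : ∃ i, x ∈ (ts i).varFinset := by simpa using h
    have h1 := termSize_le_subst τ hi
    have h2 := termSize_le_of_func F (fun j => (ts j).subst τ) i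
    rw [e] at h1
    exact absurd (h1.trans_lt h2) (lt_irrefl _)

/-- Two distinct unifiable terms yield a variable `x` and a term `r` without `x` to which every
unifier has to map `x`. -/
theorem exists_disagreement (E : Set V) {s t : L.Term V} (hne : s ≠ t) {τ : V → L.Term V}
    (hτ : ∀ x ∉ E, τ x = .var x) (hst : s.subst τ = t.subst τ) :
    ∃ x ∈ E, ∃ r : L.Term V, x ∉ r.varFinset ∧ x ∈ s.varFinset ∪ t.varFinset ∧
      r.varFinset ⊆ s.varFinset ∪ t.varFinset ∧
      ∀ τ' : V → L.Term V, (∀ x ∉ E, τ' x = .var x) → s.subst τ' = t.subst τ' →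
        τ' x = r.subst τ' := by
  induction s generalizing t with
  -- Variables outside `E` act as constants. The given unifier `τ` only serves to exclude clashes
  -- and cycles.
  | var a =>
    by_cases ha : a ∈ E
    · by_cases hat : a ∈ t.varFinset
      · exact absurd (eq_var_of_unifier hat hst).symm hne
      · exact ⟨a, ha, t, hat, by simp, by simp, fun τ' _ h => h⟩
    · cases t with
      | var b =>
        by_cases hb : b ∈ E
        · refine ⟨b, hb, .var a, ?_, by simp, by simp, fun τ' _ h => h.symm⟩
          rintro h
          obtain rfl : b = a := by simpa using h
          exact ha hb
        · simp only [Term.subst, hτ a ha, hτ b hb] at hst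
          exact absurd hst hne
      | func G ts => simp [Term.subst, hτ a ha] at hst
  | @func n F ss ih =>
    cases t with
    | var b =>
      by_cases hb : b ∈ E
      · by_cases hbs : b ∈ (Term.func F ss).varFinset
        · exact absurd (eq_var_of_unifier hbs hst.symm) hne
        · exact ⟨b, hb, .func F ss, hbs, by simp, by simp, fun τ' _ h => h.symm⟩
      · simp [Term.subst, hτ b hb] at hst
    | @func m G ts =>
      obtain ⟨rfl, h1, h2⟩ := by simpa only [Term.subst, Term.func.injEq] using hst
      obtain rfl := eq_of_heq h1
      have h2 := eq_of_heq h2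
      obtain ⟨i, hi⟩ : ∃ i, ss i ≠ ts i := by
        by_contra! hc
        exact hne (by rw [funext hc])
      obtain ⟨x, hx, r, h3, h4, h5, h6⟩ := ih i hi (congrFun h2 i)
      have hsub : (ss i).varFinset ∪ (ts i).varFinset ⊆
          (Term.func F ss).varFinset ∪ (Term.func F ts).varFinset :=
        Finset.union_subset_union
          (Finset.subset_biUnion_of_mem (fun j => (ss j).varFinset) (Finset.mem_univ i))
          (Finset.subset_biUnion_of_mem (fun j => (ts j).varFinset) (Finset.mem_univ i))
      refine ⟨x, hx, r, h3, hsub h4, h5.trans hsub, fun τ' hτ' h => h6 τ' hτ' ?_⟩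
      simp only [Term.subst, Term.func.injEq, heq_eq_eq, true_and] at h
      exact congrFun h i

/-- Existence of most general unifiers: a unifiable set of equations in finitely many unknowns has
a unifier through which every unifier factors. -/
theorem exists_mgu {E : Set V} (hE : E.Finite) (eqs : Set (L.Term V × L.Term V))
    {τ : V → L.Term V} (hτ : ∀ x ∉ E, τ x = .var x) (hu : ∀ e ∈ eqs, e.1.subst τ = e.2.subst τ) :
    ∃ σ : V → L.Term V, (∀ x ∉ E, σ x = .var x) ∧ (∀ e ∈ eqs, e.1.subst σ = e.2.subst σ) ∧
      ∀ τ' : V → L.Term V, (∀ x ∉ E, τ' x = .var x) →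
        (∀ e ∈ eqs, e.1.subst τ' = e.2.subst τ') → ∀ x, τ' x = (σ x).subst τ' := by
  classical
  -- `M` consists of the partial solutions: the assignments absorbed by every unifier. One that
  -- eliminates as many unknowns as possible is already a unifier.
  let M : Set (V → L.Term V) := {σ | (∀ x ∉ E, σ x = .var x) ∧
    ∀ τ' : V → L.Term V, (∀ x ∉ E, τ' x = .var x) →
      (∀ e ∈ eqs, e.1.subst τ' = e.2.subst τ') → ∀ x, τ' x = (σ x).subst τ'}
  let el : (V → L.Term V) → Set V := fun σ => {z | z ∈ E ∧ ∀ x, z ∉ (σ x).varFinset}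
  have hel : ∀ σ, el σ ⊆ E := fun σ z hz => hz.1
  obtain ⟨σ, ⟨hσ1, hσ2⟩, hmin⟩ : ∃ σ ∈ M, ∀ σ' ∈ M, E.ncard - (el σ).ncard ≤
      E.ncard - (el σ').ncard := by
    have hne : ((fun σ => E.ncard - (el σ).ncard) '' M).Nonempty :=
      ⟨_, Term.var, ⟨fun _ _ => rfl, fun _ _ _ _ => rfl⟩, rfl⟩
    obtain ⟨σ, hσ, he⟩ := Nat.sInf_mem hne
    exact ⟨σ, hσ, fun σ' hσ' => he.le.trans (Nat.sInf_le ⟨σ', hσ', rfl⟩)⟩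
  refine ⟨σ, hσ1, ?_, hσ2⟩
  by_contra! hc
  obtain ⟨⟨s, t⟩, he, hne⟩ := hc
  have comp : ∀ τ' : V → L.Term V, (∀ x ∉ E, τ' x = .var x) →
      (∀ e ∈ eqs, e.1.subst τ' = e.2.subst τ') →
      (s.subst σ).subst τ' = (t.subst σ).subst τ' := by
    intro τ' h1 h2
    rw [subst_subst, subst_subst, ← funext (hσ2 τ' h1 h2)]
    exact h2 _ he
  obtain ⟨x, hx, r, hxr, hxm, hr, hall⟩ := exists_disagreement E hne hτ (comp τ hτ hu)
  have occ : ∀ y ∈ (s.subst σ).varFinset ∪ (t.subst σ).varFinset, ∃ z, y ∈ (σ z).varFinset := by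
    intro y hy
    rcases Finset.mem_union.1 hy with hy | hy <;>
    · obtain ⟨z, -, hz⟩ := mem_varFinset_subst.1 hy
      exact ⟨z, hz⟩
  let δ : V → L.Term V := Function.update Term.var x r
  have hδ : ∀ τ' : V → L.Term V, (∀ x ∉ E, τ' x = .var x) →
      (∀ e ∈ eqs, e.1.subst τ' = e.2.subst τ') → ∀ y, (δ y).subst τ' = τ' y := by
    intro τ' h1 h2 y
    by_cases hy : y = x
    · subst hy
      simpa [δ] using (hall τ' h1 (comp τ' h1 h2)).symm
    · simp [δ, hy, Term.subst]
  -- A remaining disagreement lets `x ↦ r` be composed with `σ`. No unifier is lost, and `x`, which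
  -- still occurred in the image of `σ`, is eliminated as well, contradicting maximality.
  let σ' : V → L.Term V := fun y => (σ y).subst δ
  have hσ' : σ' ∈ M := by
    refine ⟨fun y hy => ?_, fun τ' h1 h2 y => ?_⟩
    · have : y ≠ x := fun h => hy (h ▸ hx)
      simp [σ', hσ1 y hy, δ, this, Term.subst]
    · rw [subst_subst, funext (hδ τ' h1 h2)]
      exact hσ2 τ' h1 h2 y
  have hmem : ∀ y z, y ∈ (δ z).varFinset → (y = z ∧ z ≠ x) ∨ y ∈ r.varFinset := by
    intro y z hy
    by_cases hz : z = x
    · subst hz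
      exact Or.inr (by simpa [δ] using hy)
    · exact Or.inl ⟨by simpa [δ, hz] using hy, hz⟩
  have hss : el σ ⊂ el σ' := by
    refine Set.ssubset_iff_of_subset ?_ |>.2 ⟨x, ⟨hx, fun y hy => ?_⟩, fun h => ?_⟩
    · rintro z ⟨hz, hz'⟩
      refine ⟨hz, fun y hy => ?_⟩
      obtain ⟨a, ha, hza⟩ := mem_varFinset_subst.1 hy
      rcases hmem _ _ hza with ⟨rfl, -⟩ | h
      · exact hz' y ha
      · obtain ⟨b, hb⟩ := occ z (hr h)
        exact hz' b hb
    · obtain ⟨a, ha, hza⟩ := mem_varFinset_subst.1 hy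
      rcases hmem _ _ hza with ⟨rfl, h⟩ | h
      · exact h rfl
      · exact hxr h
    · obtain ⟨b, hb⟩ := occ x hxm
      exact h.2 b hb
  have h1 := Set.ncard_lt_ncard hss (hE.subset (hel σ'))
  have h2 := Set.ncard_le_ncard (hel σ') hE
  have h3 := hmin σ' hσ'
  omega

end Terms

/-! ### Switching graphs in terms of closed sets -/

section Switching

variable {N : Type*}

/-- `c` picks, for every `p ∈ P`, one `S`-edge into `p`. -/
def IsChoice (S : N → N → Prop) (P : Set N) (c : N → N) : Prop :=
  ∀ p ∈ P, S (c p) p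

/-- No `U`-edge leaves `Z` or enters `Z`. -/
def Saturated (U : N → N → Prop) (Z : Set N) : Prop :=
  ∀ a b, U a b → (a ∈ Z ↔ b ∈ Z)

/-- A finite set `P` of switched vertices with sources `S`, and a graph `U` of unswitched edges:
for every choice `c` the graph with edges `U` and `c p – p` for `p ∈ P` is connected, and all its
edges `c p – p` are bridges. -/
structure IsSwitchingTree (U S : N → N → Prop) (P : Set N) : Prop where
  finite : P.Finite
  source : ∀ p ∈ P, ∃ a, S a p
  conn : ∀ c, IsChoice S P c → ∀ Z, Saturated U Z → (∀ p ∈ P, c p ∈ Z ↔ p ∈ Z) →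
    Z = ∅ ∨ Z = Set.univ
  bridge : ∀ c, IsChoice S P c → ∀ p ∈ P, ∃ X, c p ∈ X ∧ p ∉ X ∧ Saturated U X ∧
    ∀ q ∈ P, q ≠ p → (c q ∈ X ↔ q ∈ X)

variable {U S : N → N → Prop} {P : Set N}

theorem Saturated.diff {X Y : Set N} (hX : Saturated U X) (hY : Saturated U Y) :
    Saturated U (X \ Y) := fun a b h => by
  simp only [Set.mem_sdiff, hX a b h, hY a b h]

theorem Saturated.inter {X Y : Set N} (hX : Saturated U X) (hY : Saturated U Y) :
    Saturated U (X ∩ Y) := fun a b h => by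
  simp only [Set.mem_inter_iff, hX a b h, hY a b h]

/-! ### Bridges, contractible vertices and bottom components -/

namespace IsSwitchingTree

theorem exists_choice (h : IsSwitchingTree U S P) : ∃ c, IsChoice S P c := by
  classical
  choose! c hc using h.source
  exact ⟨c, hc⟩

/-- Replacing the edges into the switched vertices outside `X` by fixed choices. -/
theorem freeze (h : IsSwitchingTree U S P) {c : N → N} (hc : IsChoice S P c) (X : Set N) :
    IsSwitchingTree (fun a b => U a b ∨ (b ∈ P \ X ∧ a = c b)) S (P ∩ X) := by
  classical
  have key : ∀ c', IsChoice S (P ∩ X) c' →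
      IsChoice S P fun p => if p ∈ X then c' p else c p := by
    intro c' hc' p hp
    by_cases hX : p ∈ X
    · simpa [hX] using hc' p ⟨hp, hX⟩
    · simpa [hX] using hc p hp
  refine ⟨h.finite.inter_of_left X, fun p hp => h.source p hp.1, fun c' hc' Z hZ hZ' => ?_,
    fun c' hc' p hp => ?_⟩
  · refine h.conn _ (key c' hc') Z (fun a b hab => hZ a b (Or.inl hab)) fun p hp => ?_
    by_cases hX : p ∈ X
    · simpa [hX] using hZ' p ⟨hp, hX⟩
    · simpa [hX] using hZ (c p) p (Or.inr ⟨⟨hp, hX⟩, rfl⟩)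
  · obtain ⟨Y, h1, h2, h3, h4⟩ := h.bridge _ (key c' hc') p hp.1
    refine ⟨Y, by simpa [hp.2] using h1, h2, ?_, fun q hq hqp => ?_⟩
    · rintro a b (hab | ⟨hb, rfl⟩)
      · exact h3 a b hab
      · simpa [hb.2] using h4 b hb.1 fun e => hb.2 (e ▸ hp.2)
    · simpa [hq.2] using h4 q hq.1 hqp

/-- All sources of `p` lie on the same side of the bridge into `p`. -/
theorem source_mem (h : IsSwitchingTree U S P) {c : N → N} (hc : IsChoice S P c) {p : N}
    (hp : p ∈ P) {X : Set N} (h1 : c p ∈ X) (h2 : p ∉ X) (h3 : Saturated U X)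
    (h4 : ∀ q ∈ P, q ≠ p → (c q ∈ X ↔ q ∈ X)) {s : N} (hs : S s p) : s ∈ X := by
  classical
  by_contra hsX
  -- If `s` lay outside `X`, redirecting the choice at `p` to `s` would leave no edge across the
  -- boundary of `X`, against connectedness.
  have hc' : IsChoice S P (Function.update c p s) := by
    intro q hq
    by_cases hqp : q = p
    · subst hqp
      simpa using hs
    · simpa [hqp] using hc q hq
  rcases h.conn _ hc' X h3 (fun q hq => by
    by_cases hqp : q = p
    · subst hqp
      simp [hsX, h2]
    · simpa [hqp] using h4 q hq hqp) with e | e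
  · simp [e] at h1
  · simp [e] at h2

/-- Some switched vertex has all its sources in the same component of the unswitched edges. -/
theorem exists_contractible (h : IsSwitchingTree U S P) (hne : P.Nonempty) :
    ∃ q ∈ P, ∀ s s', S s q → S s' q → ∀ Z, Saturated U Z → s ∈ Z → s' ∈ Z := by
  classical
  induction hn : P.ncard using Nat.strong_induction_on generalizing U P with
  | _ n ih =>
  subst hn
  -- Over all choices and all bridges `c p – p`, the source side with the fewest switched vertices
  -- is taken.
  let Q : Set ℕ := {m | ∃ c, IsChoice S P c ∧ ∃ p ∈ P, ∃ X, c p ∈ X ∧ p ∉ X ∧ Saturated U X ∧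
    (∀ q ∈ P, q ≠ p → (c q ∈ X ↔ q ∈ X)) ∧ (X ∩ P).ncard = m}
  have hQ : Q.Nonempty := by
    obtain ⟨c, hc⟩ := h.exists_choice
    obtain ⟨p, hp⟩ := hne
    obtain ⟨X, h1, h2, h3, h4⟩ := h.bridge c hc p hp
    exact ⟨_, c, hc, p, hp, X, h1, h2, h3, h4, rfl⟩
  obtain ⟨c, hc, p, hp, X, h1, h2, h3, h4, h5⟩ := Nat.sInf_mem hQ
  have hlt : ∀ Y : Set N, ∀ q ∈ X ∩ P, q ∉ Y → Y ⊆ X → (Y ∩ P).ncard < sInf Q := by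
    intro Y q hq hqY hYX
    rw [← h5]
    refine Set.ncard_lt_ncard ?_ (h.finite.inter_of_right X)
    exact (Set.ssubset_iff_of_subset (Set.inter_subset_inter_left _ hYX)).2
      ⟨q, hq, fun h' => hqY h'.1⟩
  -- by minimality, `X` contains all sources of its elements
  have hin : ∀ q ∈ P, q ∈ X → ∀ s, S s q → s ∈ X := by
    intro q hq hqX s hs
    have hqp : q ≠ p := fun e => h2 (e ▸ hqX)
    obtain ⟨Y, k1, k2, k3, k4⟩ := h.bridge c hc q hq
    -- `Y` is the source side of the bridge into `q`. If it contains `p` and some source `s` of `q`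
    -- is outside `X`, then after redirecting `q` to `s` the set `X ∩ Y` is a source side for `p`
    -- that has lost `q`.
    by_cases hpY : p ∈ Y
    · by_contra hsX
      have hc' : IsChoice S P (Function.update c q s) := by
        intro r hr
        by_cases hrq : r = q
        · subst hrq
          simpa using hs
        · simpa [hrq] using hc r hr
      refine absurd (hlt (X ∩ Y) q ⟨hqX, hq⟩ (fun h' => k2 h'.2) Set.inter_subset_left)
        (not_lt.2 (Nat.sInf_le ⟨_, hc', p, hp, X ∩ Y, ?_, fun h' => h2 h'.1, h3.inter k3, ?_, rfl⟩))
      · rw [Function.update_of_ne hqp.symm]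
        exact ⟨h1, (k4 p hp hqp.symm).2 hpY⟩
      · intro r hr hrp
        by_cases hrq : r = q
        · subst hrq
          simp [hsX, k2]
        · simp [hrq, h4 r hr hrp, k4 r hr hrq]
    -- Here no edge crosses the boundary of `Y \ X`, so this set is empty. Then `Y` is a source side
    -- inside `X` that omits `q`, again too small.
    · have hYX : Y ⊆ X := by
        have := h.conn c hc (Y \ X) (k3.diff h3) (fun r hr => by
          by_cases hrp : r = p
          · subst hrp
            simp [h1, hpY]
          · by_cases hrq : r = q
            · subst hrq
              simp [hqX, (h4 r hr hrp).2 hqX]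
            · simp [h4 r hr hrp, k4 r hr hrq])
        rcases this with e | e
        · exact Set.sdiff_eq_empty.1 e
        · exact absurd (e ▸ Set.mem_univ q : q ∈ Y \ X).1 k2
      exact absurd (hlt Y q ⟨hqX, hq⟩ k2 hYX)
        (not_lt.2 (Nat.sInf_le ⟨c, hc, q, hq, Y, k1, k2, k3, k4, rfl⟩))
  -- a saturated set extends from `X` to the whole graph
  have hext : ∀ Z, Saturated U Z →
      Saturated (fun a b => U a b ∨ (b ∈ P \ X ∧ a = c b)) {n | if n ∈ X then n ∈ Z else c p ∈ Z} := by
    rintro Z hZ a b (hab | ⟨hb, rfl⟩)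
    · simp only [Set.mem_ofPred_eq, h3 a b hab, hZ a b hab]
    · by_cases hbp : b = p
      · subst hbp
        simp [h1, h2]
      · have : c b ∉ X := fun h' => hb.2 ((h4 b hb.1 hbp).1 h')
        simp [this, hb.2]
  have hfr := h.freeze hc X
  -- Without switched vertices in `X`, the frozen graph is connected with no choice left. Collapsing
  -- everything outside `X` onto `c p` shows that `X` is connected by unswitched edges, so `p`
  -- qualifies.
  rcases (P ∩ X).eq_empty_or_nonempty with hemp | hnon
  · refine ⟨p, hp, fun s s' hs hs' Z hZ hsZ => ?_⟩
    have hsX := h.source_mem hc hp h1 h2 h3 h4 hs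
    have hsX' := h.source_mem hc hp h1 h2 h3 h4 hs'
    rcases hfr.conn c (fun q hq => hc q hq.1) _ (hext Z hZ) (by simp [hemp]) with e | e
    · have : s ∈ (∅ : Set N) := e ▸ (by simpa [hsX] using hsZ)
      exact this.elim
    · have : s' ∈ {n | if n ∈ X then n ∈ Z else c p ∈ Z} := e ▸ Set.mem_univ s'
      simpa [hsX'] using this
  -- Otherwise induction applies with the choices outside `X` frozen. The vertex found has all its
  -- sources in `X`, and the same collapse turns their connection in the frozen graph into one by
  -- unswitched edges.
  · have hcard : (P ∩ X).ncard < P.ncard := Set.ncard_lt_ncard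
      ((Set.ssubset_iff_of_subset Set.inter_subset_left).2 ⟨p, hp, fun h' => h2 h'.2⟩) h.finite
    obtain ⟨q, hq, hq'⟩ := ih _ hcard hfr hnon rfl
    refine ⟨q, hq.1, fun s s' hs hs' Z hZ hsZ => ?_⟩
    have := hq' s s' hs hs' _ (hext Z hZ) (by simpa [hin q hq.1 hq.2 s hs] using hsZ)
    simpa [hin q hq.1 hq.2 s' hs'] using this

/-- There is a set `W` of vertices, closed under unswitched edges, which contains no source, and
such that every switched vertex `p` in `W` is attached to the part `X p` of the rest of the graph
by the edges into `p` only. -/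
theorem exists_bottom [Nonempty N] (h : IsSwitchingTree U S P) :
    ∃ (W : Set N) (X : N → Set N), W.Nonempty ∧ Saturated U W ∧
      (∀ p ∈ P, ∀ s, S s p → s ∉ W) ∧
      ∀ p ∈ P, p ∈ W → (∀ n ∈ X p, n ∉ W) ∧ Saturated U (X p) ∧ (∀ s, S s p → s ∈ X p) ∧
        ∀ q ∈ P, q ≠ p → ∀ s, S s q → (s ∈ X p ↔ q ∈ X p) := by
  classical
  induction hn : P.ncard using Nat.strong_induction_on generalizing U P with
  | _ n ih =>
  subst hn
  rcases P.eq_empty_or_nonempty with rfl | hne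
  · exact ⟨Set.univ, fun _ => ∅, Set.univ_nonempty, fun _ _ _ => by simp, by simp, by simp⟩
  obtain ⟨q, hq, hsrc⟩ := h.exists_contractible hne
  obtain ⟨c, hc⟩ := h.exists_choice
  -- Saturated sets cannot tell the sources of `q` apart, so freezing the single edge `c q – q`
  -- loses no information about the others.
  have hsrc' : ∀ s, S s q → ∀ Z, Saturated U Z → (s ∈ Z ↔ c q ∈ Z) := fun s hs Z hZ =>
    ⟨hsrc _ _ hs (hc q hq) Z hZ, hsrc _ _ (hc q hq) hs Z hZ⟩
  have hcard : (P ∩ {q}ᶜ).ncard < P.ncard := Set.ncard_lt_ncard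
    ((Set.ssubset_iff_of_subset Set.inter_subset_left).2 ⟨q, hq, fun h' => h'.2 rfl⟩) h.finite
  obtain ⟨W, X, hW, hWU, hWs, hX⟩ := ih _ hcard (h.freeze hc {q}ᶜ) rfl
  have hsat : ∀ Z, Saturated (fun a b => U a b ∨ (b ∈ P \ {q}ᶜ ∧ a = c b)) Z →
      Saturated U Z ∧ (c q ∈ Z ↔ q ∈ Z) := fun Z hZ =>
    ⟨fun a b hab => hZ a b (Or.inl hab), hZ _ _ (Or.inr ⟨⟨hq, by simp⟩, rfl⟩)⟩
  have hXs : ∀ p ∈ P, p ≠ q → p ∈ W → (∀ n ∈ X p, n ∉ W) ∧ Saturated U (X p) ∧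
      (∀ s, S s p → s ∈ X p) ∧ ∀ r ∈ P, r ≠ p → ∀ s, S s r → (s ∈ X p ↔ r ∈ X p) := by
    intro p hp hpq hpW
    obtain ⟨g1, g2, g3, g4⟩ := hX p ⟨hp, hpq⟩ hpW
    refine ⟨g1, (hsat _ g2).1, g3, fun r hr hrp s hs => ?_⟩
    by_cases hrq : r = q
    · subst hrq
      rw [hsrc' s hs _ (hsat _ g2).1, (hsat _ g2).2]
    · exact g4 r ⟨hr, hrq⟩ hrp s hs
  by_cases hqW : q ∈ W
  -- If `q` is in `W`, so are its sources, which is forbidden. The bridge into `q` cuts `W`, and the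
  -- half containing `q` is kept. The other half, with the parts hanging from its switched vertices,
  -- becomes the part of `q`.
  · obtain ⟨Y, k1, k2, k3, k4⟩ := h.bridge c hc q hq
    have hsY := fun s (hs : S s q) => h.source_mem hc hq k1 k2 k3 k4 hs
    refine ⟨W \ Y, fun p => if p = q then
      {n | (n ∈ W ∧ n ∈ Y) ∨ ∃ r ∈ P, r ∈ W ∧ r ∈ Y ∧ n ∈ X r} else X p, ⟨q, hqW, k2⟩,
      (hsat _ hWU).1.diff k3, fun p hp s hs hsW => ?_, fun p hp hpW => ?_⟩
    · by_cases hpq : p = q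
      · subst hpq
        exact hsW.2 (hsY s hs)
      · exact hWs p ⟨hp, hpq⟩ s hs hsW.1
    · by_cases hpq : p = q
      · subst hpq
        have hne : ∀ r, r ∈ Y → r ≠ p := fun r hr e => k2 (e ▸ hr)
        simp only [if_true]
        refine ⟨?_, ?_, fun s hs => Or.inl ⟨?_, hsY s hs⟩, fun r hr hrp s hs => ⟨?_, ?_⟩⟩
        · rintro n (⟨-, hn⟩ | ⟨r, hr, hrW, hrY, hn⟩) hn'
          · exact hn'.2 hn
          · exact (hXs r hr (hne r hrY) hrW).1 n hn hn'.1
        · intro a b hab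
          simp only [Set.mem_ofPred_eq, (hsat _ hWU).1 a b hab, k3 a b hab]
          refine or_congr Iff.rfl (exists_congr fun r => and_congr_right fun hr =>
            and_congr_right fun hrW => and_congr_right fun hrY => ?_)
          exact (hXs r hr (hne r hrY) hrW).2.1 a b hab
        · rw [hsrc' s hs _ (hsat _ hWU).1, (hsat _ hWU).2]
          exact hqW
        · rintro (⟨hsW, -⟩ | ⟨t, ht, htW, htY, hst⟩)
          · exact absurd hsW (hWs r ⟨hr, hrp⟩ s hs)
          · by_cases hrt : r = t
            · subst hrt
              exact Or.inl ⟨htW, htY⟩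
            · exact Or.inr ⟨t, ht, htW, htY,
                ((hXs t ht (hne t htY) htW).2.2.2 r hr hrt s hs).1 hst⟩
        · rintro (⟨hrW, hrY⟩ | ⟨t, ht, htW, htY, hrt⟩)
          · exact Or.inr ⟨r, hr, hrW, hrY, (hXs r hr hrp hrW).2.2.1 s hs⟩
          · have hX' := hXs t ht (hne t htY) htW
            have : r ≠ t := fun e => hX'.1 r hrt (e ▸ htW)
            exact Or.inr ⟨t, ht, htW, htY, (hX'.2.2.2 r hr this s hs).2 hrt⟩
      · simp only [if_neg hpq]
        obtain ⟨g1, g2⟩ := hXs p hp hpq hpW.1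
        exact ⟨fun n hn hn' => g1 n hn hn'.1, g2⟩
  · refine ⟨W, X, hW, (hsat _ hWU).1, fun p hp s hs hsW => ?_, fun p hp hpW =>
      hXs p hp (fun e => hqW (e ▸ hpW)) hpW⟩
    by_cases hpq : p = q
    · subst hpq
      rw [hsrc' s hs _ (hsat _ hWU).1, (hsat _ hWU).2] at hsW
      exact hqW hsW
    · exact hWs p ⟨hp, hpq⟩ s hs hsW

end IsSwitchingTree

end Switching

/-! ### Formulas: vertices, bound variables, simultaneous substitution -/

namespace Formula

variable {L : FirstOrder.Language.{u, v}} {V : Type w}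

theorem sub?_append (A : Formula L V) (p q : List Dir) :
    A.sub? (p ++ q) = (A.sub? p).bind fun B => B.sub? q := by
  induction p generalizing A with
  | nil => simp [sub?]
  | cons d p ih => cases A <;> cases d <;> simp [sub?, ih]

theorem finite_vertices (A : Formula L V) : {p | ∃ B, A.sub? p = some B}.Finite := by
  have key : ∀ (A : Formula L V) (s : Set (List Dir)), s.Finite →
      (∀ p, (∃ B, A.sub? p = some B) → p = [] ∨ p ∈ s) → {p | ∃ B, A.sub? p = some B}.Finite :=
    fun A s hs h => (hs.insert []).subset h
  induction A with
  | atom P ts =>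
    refine key _ ∅ Set.finite_empty ?_
    rintro (_ | ⟨_ | _, p⟩) ⟨B, hB⟩ <;> simp [sub?] at hB ⊢
  | tensor A B ihA ihB =>
    refine key _ _ ((ihA.image (.left :: ·)).union (ihB.image (.right :: ·))) ?_
    rintro (_ | ⟨_ | _, p⟩) ⟨C, hC⟩ <;> simp [sub?] at hC ⊢ <;> exact ⟨_, hC⟩
  | par A B ihA ihB =>
    refine key _ _ ((ihA.image (.left :: ·)).union (ihB.image (.right :: ·))) ?_
    rintro (_ | ⟨_ | _, p⟩) ⟨C, hC⟩ <;> simp [sub?] at hC ⊢ <;> exact ⟨_, hC⟩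
  | all x A ih =>
    refine key _ _ (ih.image (.body :: ·)) ?_
    rintro (_ | ⟨_ | _, p⟩) ⟨C, hC⟩ <;> simp [sub?] at hC ⊢; exact ⟨_, hC⟩
  | ex x A ih =>
    refine key _ _ (ih.image (.body :: ·)) ?_
    rintro (_ | ⟨_ | _, p⟩) ⟨C, hC⟩ <;> simp [sub?] at hC ⊢; exact ⟨_, hC⟩

/-- The set of bound variables. -/
def bv : Formula L V → Set V
  | .atom _ _ => ∅
  | .tensor A B => A.bv ∪ B.bv
  | .par A B => A.bv ∪ B.bv
  | .all x A => insert x A.bv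
  | .ex x A => insert x A.bv

theorem finite_bv (A : Formula L V) : A.bv.Finite := by
  induction A with
  | atom => exact Set.finite_empty
  | tensor _ _ h h' => exact h.union h'
  | par _ _ h h' => exact h.union h'
  | all x _ h => exact h.insert x
  | ex x _ h => exact h.insert x

theorem exists_sub?_of_mem_bv {A : Formula L V} {x : V} (h : x ∈ A.bv) :
    ∃ p C, A.sub? p = some (.all x C) ∨ A.sub? p = some (.ex x C) := by
  induction A with
  | atom => exact h.elim
  | tensor A B ihA ihB =>
    rcases h with h | h
    · obtain ⟨p, hp⟩ := ihA h
      exact ⟨.left :: p, by simpa [sub?] using hp⟩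
    · obtain ⟨p, hp⟩ := ihB h
      exact ⟨.right :: p, by simpa [sub?] using hp⟩
  | par A B ihA ihB =>
    rcases h with h | h
    · obtain ⟨p, hp⟩ := ihA h
      exact ⟨.left :: p, by simpa [sub?] using hp⟩
    · obtain ⟨p, hp⟩ := ihB h
      exact ⟨.right :: p, by simpa [sub?] using hp⟩
  | all y A ih =>
    rcases h with rfl | h
    · exact ⟨[], A, by simp [sub?]⟩
    · obtain ⟨p, hp⟩ := ih h
      exact ⟨.body :: p, by simpa [sub?] using hp⟩
  | ex y A ih =>
    rcases h with rfl | h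
    · exact ⟨[], A, by simp [sub?]⟩
    · obtain ⟨p, hp⟩ := ih h
      exact ⟨.body :: p, by simpa [sub?] using hp⟩

theorem mem_bv_of_sub? {A C : Formula L V} {x : V} {p : List Dir}
    (h : A.sub? p = some (.all x C) ∨ A.sub? p = some (.ex x C)) : x ∈ A.bv := by
  induction p generalizing A with
  | nil => rcases h with h | h <;> simp only [sub?, Option.some.injEq] at h <;> simp [h, bv]
  | cons d p ih =>
    cases A <;> cases d <;> simp only [sub?, reduceCtorEq, or_self] at h <;>
      simp [bv, ih h]

/-! ### Capture conditions and simultaneous substitution -/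

variable [DecidableEq V]

theorem freeFor_of_bv {A : Formula L V} {x : V} {t : L.Term V}
    (h : ∀ y ∈ A.bv, y ∉ t.varFinset) : A.FreeFor x t := by
  induction A with
  | atom => trivial
  | tensor A B ihA ihB =>
    exact ⟨ihA fun y hy => h y (Or.inl hy), ihB fun y hy => h y (Or.inr hy)⟩
  | par A B ihA ihB =>
    exact ⟨ihA fun y hy => h y (Or.inl hy), ihB fun y hy => h y (Or.inr hy)⟩
  | all y A ih => exact Or.inr ⟨h y (Or.inl rfl), ih fun z hz => h z (Or.inr hz)⟩
  | ex y A ih => exact Or.inr ⟨h y (Or.inl rfl), ih fun z hz => h z (Or.inr hz)⟩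

/-- Simultaneous substitution for the free occurrences of all variables (without renaming of bound
variables). -/
def msubst : Formula L V → (V → L.Term V) → Formula L V
  | .atom P ts, σ => .atom P fun i => (ts i).subst σ
  | .tensor A B, σ => .tensor (A.msubst σ) (B.msubst σ)
  | .par A B, σ => .par (A.msubst σ) (B.msubst σ)
  | .all x A, σ => .all x (A.msubst (Function.update σ x (.var x)))
  | .ex x A, σ => .ex x (A.msubst (Function.update σ x (.var x)))

theorem bv_msubst (A : Formula L V) (σ : V → L.Term V) : (A.msubst σ).bv = A.bv := by
  induction A generalizing σ with
  | atom => rfl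
  | tensor _ _ h h' => simp [msubst, bv, h, h']
  | par _ _ h h' => simp [msubst, bv, h, h']
  | all _ _ h => simp [msubst, bv, h]
  | ex _ _ h => simp [msubst, bv, h]

theorem update_var_eq {A : Set V} {x : V} {σ : V → L.Term V}
    (h : ∀ y ∈ A \ {x}, σ y = .var y) :
    ∀ y ∈ A, Function.update σ x (.var x) y = .var y := by
  intro y hy
  by_cases hyx : y = x
  · subst hyx
    simp
  · simpa [hyx] using h y ⟨hy, hyx⟩

theorem msubst_eq_self {A : Formula L V} {σ : V → L.Term V} (h : ∀ x ∈ A.fv, σ x = .var x) :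
    A.msubst σ = A := by
  induction A generalizing σ with
  | atom P ts =>
    simp only [msubst]
    congr 1
    funext i
    exact subst_eq_self fun x hx => h x ⟨i, hx⟩
  | tensor A B ihA ihB =>
    simp [msubst, ihA fun x hx => h x (Or.inl hx), ihB fun x hx => h x (Or.inr hx)]
  | par A B ihA ihB =>
    simp [msubst, ihA fun x hx => h x (Or.inl hx), ihB fun x hx => h x (Or.inr hx)]
  | all y A ih => simp [msubst, ih (update_var_eq h)]
  | ex y A ih => simp [msubst, ih (update_var_eq h)]

/-- This gives the eigenvariable condition of the `∀` rule once `σ` has been applied to the context.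
-/
theorem exists_of_mem_fv_msubst {A : Formula L V} {σ : V → L.Term V} {y : V}
    (h : y ∈ (A.msubst σ).fv) : ∃ x ∈ A.fv, y ∈ (σ x).varFinset := by
  have key : ∀ (B : Formula L V) (z : V) (σ : V → L.Term V),
      (∃ x ∈ B.fv, y ∈ (Function.update σ z (.var z) x).varFinset) → y ≠ z →
      ∃ x ∈ B.fv \ {z}, y ∈ (σ x).varFinset := by
    rintro B z σ ⟨x, hx, hy⟩ hyz
    by_cases hxz : x = z
    · subst hxz
      exact absurd (by simpa using hy) hyz
    · exact ⟨x, ⟨hx, hxz⟩, by simpa [hxz] using hy⟩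
  induction A generalizing σ with
  | atom P ts =>
    obtain ⟨i, hi⟩ := h
    obtain ⟨x, hx, hy⟩ := mem_varFinset_subst.1 hi
    exact ⟨x, ⟨i, hx⟩, hy⟩
  | tensor A B ihA ihB =>
    rcases h with h | h
    · exact (ihA h).imp fun x hx => ⟨Or.inl hx.1, hx.2⟩
    · exact (ihB h).imp fun x hx => ⟨Or.inr hx.1, hx.2⟩
  | par A B ihA ihB =>
    rcases h with h | h
    · exact (ihA h).imp fun x hx => ⟨Or.inl hx.1, hx.2⟩
    · exact (ihB h).imp fun x hx => ⟨Or.inr hx.1, hx.2⟩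
  | all z A ih => exact key A z σ (ih h.1) h.2
  | ex z A ih => exact key A z σ (ih h.1) h.2

/-- The `∃` rule wants its premise as a single substitution into the body of its conclusion. The
simultaneous substitution is therefore split: first every variable but `x`, then `x`. The second
step does not disturb the terms inserted by the first, because they do not contain `x`. -/
theorem subst_msubst_update {A : Formula L V} {σ : V → L.Term V} {x : V}
    (h : ∀ v ∈ A.fv, v ≠ x → x ∉ (σ v).varFinset) (hx : x ∉ A.bv) :
    (A.msubst (Function.update σ x (.var x))).subst x (σ x) = A.msubst σ := by
  have key : ∀ (B : Formula L V) (y : V) (σ : V → L.Term V),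
      (∀ v ∈ B.fv \ {y}, v ≠ x → x ∉ (σ v).varFinset) → x ≠ y →
      ∀ v ∈ B.fv, v ≠ x → x ∉ (Function.update σ y (.var y) v).varFinset := by
    intro B y σ h hxy v hv hvx
    by_cases hvy : v = y
    · subst hvy
      simpa using hxy
    · simpa [hvy] using h v ⟨hv, hvy⟩ hvx
  induction A generalizing σ with
  | atom P ts =>
    simp only [msubst, subst]
    congr 1
    funext i
    rw [subst_subst]
    refine subst_congr fun v hv => ?_
    by_cases hvx : v = x
    · subst hvx
      simp [Term.subst]
    · rw [Function.update_of_ne hvx]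
      refine subst_eq_self fun z hz => ?_
      have : z ≠ x := fun e => h v ⟨i, hv⟩ hvx (e ▸ hz)
      simp [this]
  | tensor A B ihA ihB =>
    simp [msubst, subst, ihA (fun v hv => h v (Or.inl hv)) fun h' => hx (Or.inl h'),
      ihB (fun v hv => h v (Or.inr hv)) fun h' => hx (Or.inr h')]
  | par A B ihA ihB =>
    simp [msubst, subst, ihA (fun v hv => h v (Or.inl hv)) fun h' => hx (Or.inl h'),
      ihB (fun v hv => h v (Or.inr hv)) fun h' => hx (Or.inr h')]
  | all y A ih =>
    have hxy : x ≠ y := fun e => hx (Or.inl e)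
    have := ih (key A y σ h hxy) fun h' => hx (Or.inr h')
    rw [Function.update_of_ne hxy, Function.update_comm hxy.symm] at this
    simp [msubst, subst, hxy.symm, this]
  | ex y A ih =>
    have hxy : x ≠ y := fun e => hx (Or.inl e)
    have := ih (key A y σ h hxy) fun h' => hx (Or.inr h')
    rw [Function.update_of_ne hxy, Function.update_comm hxy.symm] at this
    simp [msubst, subst, hxy.symm, this]

end Formula

/-! ### Sequents -/

namespace Sequent

variable {L : FirstOrder.Language.{u, v}} {V : Type w} {ι : Type}

theorem finite_vertices [Finite ι] (Γ : Sequent L V ι) : {a | Γ.IsVertex a}.Finite := by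
  refine (Set.finite_iUnion fun i : ι => ((Γ i).finite_vertices.image (Prod.mk i))).subset ?_
  rintro ⟨i, p⟩ h
  exact Set.mem_iUnion.2 ⟨i, p, h, rfl⟩

theorem isVertex_of_append {Γ : Sequent L V ι} {i : ι} {p q : List Dir}
    (h : Γ.IsVertex (i, p ++ q)) : Γ.IsVertex (i, p) := by
  obtain ⟨A, hA⟩ := h
  simp only [at?, Formula.sub?_append] at hA
  cases hB : (Γ i).sub? p with
  | none => simp [hB] at hA
  | some B => exact ⟨B, hB⟩

theorem isVertex_root (Γ : Sequent L V ι) (i : ι) : Γ.IsVertex (i, []) :=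
  ⟨Γ i, by simp [at?, Formula.sub?]⟩

end Sequent

/-! ### Nets with a fixed unifier -/

section Nets

variable {L : FirstOrder.Language.{u, v}} {V : Type w} [DecidableEq V] {ι ι' : Type}

/-- Leaps with respect to an arbitrary assignment `σ`. -/
def Leap (Γ : Sequent L V ι) (σ : V → L.Term V) (a b : Pos ι) : Prop :=
  ∃ x A y B, Γ.at? a = some (.ex x A) ∧ Γ.at? b = some (.all y B) ∧ y ∈ (σ x).varFinset

/-- The directed edges: from a vertex to its parent, and the leaps. -/
def Arrow (Γ : Sequent L V ι) (σ : V → L.Term V) (a b : Pos ι) : Prop :=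
  (Γ.IsVertex a ∧ ∃ d, a = (b.1, b.2 ++ [d])) ∨ Leap Γ σ a b

/-- A choice of one edge into each switched vertex. -/
def IsArrowChoice (Γ : Sequent L V ι) (σ : V → L.Term V) (c : Pos ι → Pos ι) : Prop :=
  ∀ p, Γ.IsSwitched p → Arrow Γ σ (c p) p

/-- All switchings for the leaps given by `σ` are connected, and their directed edges are
bridges. -/
structure IsCorrectFor (Γ : Sequent L V ι) (θ : Set (Sym2 (Pos ι))) (σ : V → L.Term V) :
    Prop where
  conn : ∀ c, IsArrowChoice Γ σ c → ∀ Z : Set (Pos ι), (∀ a b, s(a, b) ∈ θ → (a ∈ Z ↔ b ∈ Z)) →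
    (∀ a b, Arrow Γ σ a b → (Γ.IsSwitched b → a = c b) → (a ∈ Z ↔ b ∈ Z)) →
    (∀ a, Γ.IsVertex a → a ∈ Z) ∨ (∀ a, Γ.IsVertex a → a ∉ Z)
  bridge : ∀ c, IsArrowChoice Γ σ c → ∀ a b, Arrow Γ σ a b → (Γ.IsSwitched b → a = c b) →
    ∃ Z : Set (Pos ι), a ∈ Z ∧ b ∉ Z ∧ (∀ a' b', s(a', b') ∈ θ → (a' ∈ Z ↔ b' ∈ Z)) ∧
      ∀ a' b', Arrow Γ σ a' b' → (Γ.IsSwitched b' → a' = c b') → (a', b') ≠ (a, b) →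
        (a' ∈ Z ↔ b' ∈ Z)

/-- A unification net in which the free variables may still be subject to the substitution `σ`,
which does not introduce variables quantified in `Γ` other than by leaps. -/
structure IsNet (D : Duality L) (Γ : Sequent L V ι) (θ : Set (Sym2 (Pos ι)))
    (σ : V → L.Term V) : Prop where
  nonempty : Nonempty ι
  clean : Γ.Clean
  linking : IsLinking D Γ θ
  unif : ∀ (a b : Pos ι) (n : ℕ) (P P' : L.Relations n) (ts ts' : Fin n → L.Term V),
    s(a, b) ∈ θ → Γ.at? a = some (.atom P ts) → Γ.at? b = some (.atom P' ts') →
    ∀ i, (ts i).subst σ = (ts' i).subst σ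
  free : ∀ x, Γ.IsFree x → ∀ a y, Γ.Quantifies a y → y ∉ (σ x).varFinset
  ex : ∀ a x A b y B, Γ.at? a = some (.ex x A) → Γ.at? b = some (.ex y B) → y ∉ (σ x).varFinset
  univ : ∀ a y A, Γ.at? a = some (.all y A) → σ y = .var y
  correct : IsCorrectFor Γ θ σ

/-! ### Elementary facts on directed edges, switched vertices and links -/

theorem Arrow.isVertex {Γ : Sequent L V ι} {σ : V → L.Term V} {a b : Pos ι}
    (h : Arrow Γ σ a b) : Γ.IsVertex a ∧ Γ.IsVertex b := by
  rcases h with ⟨ha, d, rfl⟩ | ⟨x, A, y, B, ha, hb, -⟩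
  · exact ⟨ha, Sequent.isVertex_of_append ha⟩
  · exact ⟨⟨_, ha⟩, ⟨_, hb⟩⟩

omit [DecidableEq V] in
theorem Sequent.IsSwitched.isVertex {Γ : Sequent L V ι} {a : Pos ι} (h : Γ.IsSwitched a) :
    Γ.IsVertex a := by
  rcases h with ⟨A, B, h⟩ | ⟨y, A, h⟩ <;> exact ⟨_, h⟩

omit [DecidableEq V] in
theorem Sequent.at?_append {Γ : Sequent L V ι} {a : Pos ι} {A : Formula L V}
    (h : Γ.at? a = some A) (d : Dir) : Γ.at? (a.1, a.2 ++ [d]) = A.sub? [d] := by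
  have h : (Γ a.1).sub? a.2 = some A := h
  simp [Sequent.at?, Formula.sub?_append, h]

theorem Sequent.IsSwitched.exists_arrow {Γ : Sequent L V ι} {b : Pos ι} (σ : V → L.Term V)
    (h : Γ.IsSwitched b) : ∃ a, Arrow Γ σ a b := by
  rcases h with ⟨A, B, h⟩ | ⟨y, A, h⟩
  · exact ⟨(b.1, b.2 ++ [.left]), Or.inl ⟨⟨A, by simp [Sequent.at?_append h, Formula.sub?]⟩, _, rfl⟩⟩
  · exact ⟨(b.1, b.2 ++ [.body]), Or.inl ⟨⟨A, by simp [Sequent.at?_append h, Formula.sub?]⟩, _, rfl⟩⟩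

omit [DecidableEq V] in
theorem IsLinking.isLeaf {D : Duality L} {Γ : Sequent L V ι} {θ : Set (Sym2 (Pos ι))}
    (h : IsLinking D Γ θ) {a b : Pos ι} (hab : s(a, b) ∈ θ) : Γ.IsLeaf a ∧ Γ.IsLeaf b := by
  obtain ⟨a', b', n, P, ts, ts', he, h1, h2⟩ := h.1 _ hab
  rcases Sym2.eq_iff.1 he with ⟨rfl, rfl⟩ | ⟨rfl, rfl⟩
  · exact ⟨⟨_, _, _, h1⟩, ⟨_, _, _, h2⟩⟩
  · exact ⟨⟨_, _, _, h2⟩, ⟨_, _, _, h1⟩⟩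

omit [DecidableEq V] in
theorem Sequent.IsLeaf.isVertex {Γ : Sequent L V ι} {a : Pos ι} (h : Γ.IsLeaf a) :
    Γ.IsVertex a := by
  obtain ⟨n, P, ts, h⟩ := h
  exact ⟨_, h⟩

/-! ### Restriction to a part of a net -/

/-- An embedding of forests, which preserves the subformulas at all vertices. -/
structure IsForestEmb (Γ' : Sequent L V ι') (Γ : Sequent L V ι) (φ : Pos ι' → Pos ι) : Prop where
  inj : Function.Injective φ
  at? : ∀ a, Γ'.at? a = Γ.at? (φ a)
  child : ∀ a d, φ (a.1, a.2 ++ [d]) = ((φ a).1, (φ a).2 ++ [d])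

namespace IsForestEmb

variable {Γ' : Sequent L V ι'} {Γ : Sequent L V ι} {φ : Pos ι' → Pos ι}

omit [DecidableEq V] in
theorem isVertex (h : IsForestEmb Γ' Γ φ) (a : Pos ι') : Γ'.IsVertex a ↔ Γ.IsVertex (φ a) := by
  simp [Sequent.IsVertex, h.at?]

omit [DecidableEq V] in
theorem isSwitched (h : IsForestEmb Γ' Γ φ) (a : Pos ι') :
    Γ'.IsSwitched a ↔ Γ.IsSwitched (φ a) := by
  simp [Sequent.IsSwitched, h.at?]

omit [DecidableEq V] in
theorem quantifies (h : IsForestEmb Γ' Γ φ) (a : Pos ι') (x : V) :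
    Γ'.Quantifies a x ↔ Γ.Quantifies (φ a) x := by
  simp [Sequent.Quantifies, h.at?]

theorem arrow (h : IsForestEmb Γ' Γ φ) (σ : V → L.Term V) (a b : Pos ι') :
    Arrow Γ' σ a b ↔ Arrow Γ σ (φ a) (φ b) := by
  have : (∃ d, a = (b.1, b.2 ++ [d])) ↔ ∃ d, φ a = ((φ b).1, (φ b).2 ++ [d]) :=
    exists_congr fun d => by rw [← h.child, h.inj.eq_iff]
  simp only [Arrow, Leap, h.isVertex, h.at?, this]

/-- Everything outside the image is attached to the image at the vertex `φ r` only. -/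
theorem isCorrectFor (h : IsForestEmb Γ' Γ φ) {θ : Set (Sym2 (Pos ι))} {σ : V → L.Term V}
    (hc : IsCorrectFor Γ θ σ) (r : Pos ι')
    (hlink : ∀ a b, s(a, b) ∈ θ → (a ∈ Set.range φ ↔ b ∈ Set.range φ))
    (hun : ∀ a b, Arrow Γ σ a b → ¬ Γ.IsSwitched b →
      (a ∈ Set.range φ ↔ b ∈ Set.range φ) ∨ (a = φ r ∧ b ∉ Set.range φ))
    (hsw : ∀ b, Γ.IsSwitched b → b ∉ Set.range φ →
      ∃ a, Arrow Γ σ a b ∧ (a ∉ Set.range φ ∨ a = φ r)) :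
    IsCorrectFor Γ' (Sym2.map φ ⁻¹' θ) σ := by
  classical
  choose! c₀ hc₀ hc₀' using hsw
  -- A choice on the part extends by the fixed `c₀`, whose edges outside the image start outside it
  -- or at `φ r`.
  let ext : (Pos ι' → Pos ι') → Pos ι → Pos ι := fun c => Function.extend φ (φ ∘ c) c₀
  have ext_in : ∀ c a, ext c (φ a) = φ (c a) := fun c a => h.inj.extend_apply _ _ a
  have ext_out : ∀ c b, b ∉ Set.range φ → ext c b = c₀ b := fun c b hb =>
    Function.extend_apply' _ _ b hb
  have hext : ∀ c, IsArrowChoice Γ' σ c → IsArrowChoice Γ σ (ext c) := by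
    intro c hc p hp
    by_cases hpr : p ∈ Set.range φ
    · obtain ⟨q, rfl⟩ := hpr
      rw [ext_in, ← h.arrow]
      exact hc q ((h.isSwitched q).2 hp)
    · rw [ext_out c p hpr]
      exact hc₀ p hp hpr
  -- `ψ` retracts the whole graph onto the part and collapses the outside to `r`. Pulling closed
  -- sets back along `ψ` transfers connectedness; for bridges, pulling cuts back along `φ` is
  -- enough.
  let ψ : Pos ι → Pos ι' := Function.extend φ id fun _ => r
  have ψ_in : ∀ a, ψ (φ a) = a := fun a => h.inj.extend_apply _ _ a
  have ψ_out : ∀ b, b ∉ Set.range φ → ψ b = r := fun b hb => Function.extend_apply' _ _ b hb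
  refine ⟨fun c hcc Z hZ hZ' => ?_, fun c hcc a b hab hcb => ?_⟩
  · have := hc.conn (ext c) (hext c hcc) (ψ ⁻¹' Z) (fun a b hab => ?_) (fun a b hab hcb => ?_)
    · refine this.imp (fun hv a ha => ?_) (fun hv a ha => ?_) <;>
        simpa [ψ_in] using hv (φ a) ((h.isVertex a).1 ha)
    · by_cases ha : a ∈ Set.range φ
      · obtain ⟨b, rfl⟩ := (hlink a b hab).1 ha
        obtain ⟨a, rfl⟩ := ha
        simpa [ψ_in] using hZ a b (by simpa using hab)
      · have hb := fun h' => ha ((hlink a b hab).2 h')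
        simp [ψ_out a ha, ψ_out b hb]
    · by_cases hb : b ∈ Set.range φ
      · have ha : a ∈ Set.range φ := by
          by_cases hbs : Γ.IsSwitched b
          · obtain ⟨b, rfl⟩ := hb
            rw [hcb hbs, ext_in]
            exact ⟨_, rfl⟩
          · rcases hun a b hab hbs with h' | h'
            · exact h'.2 hb
            · exact absurd hb h'.2
        obtain ⟨b, rfl⟩ := hb
        obtain ⟨a, rfl⟩ := ha
        simp only [Set.mem_preimage, ψ_in]
        refine hZ' a b ((h.arrow σ a b).2 hab) fun hbs => h.inj ?_
        rw [hcb ((h.isSwitched b).1 hbs), ext_in]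
      · have : ψ a = ψ b := by
          rw [ψ_out b hb]
          have : a ∉ Set.range φ ∨ a = φ r := by
            by_cases hbs : Γ.IsSwitched b
            · rw [hcb hbs, ext_out c b hb]
              exact hc₀' b hbs hb
            · rcases hun a b hab hbs with h' | h'
              · exact Or.inl fun h'' => hb (h'.1 h'')
              · exact Or.inr h'.1
          rcases this with h' | rfl
          · exact ψ_out a h'
          · exact ψ_in r
        simp [this]
  · obtain ⟨Z, h1, h2, h3, h4⟩ := hc.bridge (ext c) (hext c hcc) (φ a) (φ b)
      ((h.arrow σ a b).1 hab) fun hbs => by rw [ext_in, hcb ((h.isSwitched b).2 hbs)]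
    refine ⟨φ ⁻¹' Z, h1, h2, fun a' b' hab' => h3 _ _ (by simpa using hab'),
      fun a' b' hab' hcb' hne => h4 _ _ ((h.arrow σ a' b').1 hab') (fun hbs => ?_) fun e => hne ?_⟩
    · rw [ext_in, hcb' ((h.isSwitched b').2 hbs)]
    · obtain ⟨e1, e2⟩ := Prod.mk.inj e
      rw [h.inj e1, h.inj e2]

/-- A variable may become free only if its quantifier is outside the image and has no outgoing leap.
If it is existential, its term then contains neither universal variables (no leap) nor existential
ones (field `ex`) of `Γ`; if it is universal, its term is the variable itself, no longer quantified.
So the condition on free variables survives. -/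
theorem isNet (h : IsForestEmb Γ' Γ φ) {D : Duality L} {θ : Set (Sym2 (Pos ι))}
    {σ : V → L.Term V} (hn : IsNet D Γ θ σ) (r : Pos ι')
    (hfree : ∀ x, Γ'.IsFree x → Γ.IsFree x ∨
      ∃ a, a ∉ Set.range φ ∧ Γ.Quantifies a x ∧ ∀ b, ¬ Leap Γ σ a b)
    (hlink : ∀ a b, s(a, b) ∈ θ → (a ∈ Set.range φ ↔ b ∈ Set.range φ))
    (hun : ∀ a b, Arrow Γ σ a b → ¬ Γ.IsSwitched b →
      (a ∈ Set.range φ ↔ b ∈ Set.range φ) ∨ (a = φ r ∧ b ∉ Set.range φ))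
    (hsw : ∀ b, Γ.IsSwitched b → b ∉ Set.range φ →
      ∃ a, Arrow Γ σ a b ∧ (a ∉ Set.range φ ∨ a = φ r)) :
    IsNet D Γ' (Sym2.map φ ⁻¹' θ) σ where
  nonempty := ⟨r.1⟩
  clean := by
    refine ⟨fun a b x ha hb => h.inj (hn.clean.1 _ _ x ((h.quantifies a x).1 ha)
      ((h.quantifies b x).1 hb)), fun a x ha hx => ?_⟩
    have ha' := (h.quantifies a x).1 ha
    rcases hfree x hx with hx | ⟨b, hb, hbx, -⟩
    · exact hn.clean.2 _ x ha' hx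
    · exact hb ⟨a, hn.clean.1 _ _ x ha' hbx⟩
  linking := by
    refine ⟨fun s hs => ?_, fun s hs s' hs' a ha ha' => ?_, fun a ha => ?_⟩
    · induction s with
      | _ a b =>
      obtain ⟨a', b', n, P, ts, ts', he, h1, h2⟩ := hn.linking.1 _ hs
      rw [Sym2.map_mk] at he
      rcases Sym2.eq_iff.1 he with ⟨rfl, rfl⟩ | ⟨rfl, rfl⟩
      · exact ⟨a, b, n, P, ts, ts', rfl, (h.at? a).trans h1, (h.at? b).trans h2⟩
      · exact ⟨b, a, n, P, ts, ts', Sym2.eq_swap, (h.at? b).trans h1, (h.at? a).trans h2⟩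
    · exact Sym2.map.injective h.inj (hn.linking.2.1 _ hs _ hs' (φ a)
        (Sym2.mem_map.2 ⟨a, ha, rfl⟩) (Sym2.mem_map.2 ⟨a, ha', rfl⟩))
    · obtain ⟨n, P, ts, ha⟩ := ha
      obtain ⟨t, ht, hat⟩ := hn.linking.2.2 (φ a) ⟨n, P, ts, (h.at? a).symm.trans ha⟩
      obtain ⟨b, rfl⟩ := Sym2.mem_iff_exists.1 hat
      obtain ⟨b, rfl⟩ := (hlink _ _ ht).1 ⟨a, rfl⟩
      exact ⟨s(a, b), by simpa using ht, by simp⟩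
  unif a b n P P' ts ts' hab ha hb := hn.unif (φ a) (φ b) n P P' ts ts' (by simpa using hab)
    ((h.at? a).symm.trans ha) ((h.at? b).symm.trans hb)
  free x hx a y hay hy := by
    have hay' := (h.quantifies a y).1 hay
    rcases hfree x hx with hx | ⟨b, hb, ⟨A, hA | hA⟩, hleap⟩
    · exact hn.free x hx _ y hay' hy
    · rw [hn.univ b x A hA] at hy
      obtain rfl : y = x := by simpa using hy
      exact hb ⟨a, hn.clean.1 _ _ y hay' ⟨A, Or.inl hA⟩⟩
    · obtain ⟨B, hB | hB⟩ := hay'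
      · exact hleap _ ⟨x, A, y, B, hA, hB, hy⟩
      · exact hn.ex _ _ _ _ _ _ hA hB hy
  ex a x A b y B ha hb := hn.ex (φ a) x A (φ b) y B ((h.at? a).symm.trans ha)
    ((h.at? b).symm.trans hb)
  univ a y A ha := hn.univ (φ a) y A ((h.at? a).symm.trans ha)
  correct := h.isCorrectFor hn.correct r hlink hun hsw

omit [DecidableEq V] in
theorem ncard_lt [Finite ι] (h : IsForestEmb Γ' Γ φ) {b : Pos ι} (hb : Γ.IsVertex b)
    (hb' : b ∉ Set.range φ) : {a | Γ'.IsVertex a}.ncard < {a | Γ.IsVertex a}.ncard := by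
  rw [← Set.ncard_image_of_injective _ h.inj]
  refine Set.ncard_lt_ncard ((Set.ssubset_iff_of_subset ?_).2 ⟨b, hb, ?_⟩) Γ.finite_vertices
  · rintro _ ⟨a, ha, rfl⟩
    exact (h.isVertex a).1 ha
  · rintro ⟨a, -, rfl⟩
    exact hb' ⟨a, rfl⟩

end IsForestEmb

/-! ### The last rule of a sequentialization -/

/-- The edge from `(i, [.left])` to the tensor `(i, [])` is a bridge of the whole graph, `Z` being
one of the two sides. -/
structure IsSplitting (Γ : Sequent L V ι) (θ : Set (Sym2 (Pos ι))) (σ : V → L.Term V) (i : ι)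
    (Z : Set (Pos ι)) : Prop where
  left_mem : (i, [.left]) ∈ Z
  root_notMem : (i, []) ∉ Z
  link : ∀ a b, s(a, b) ∈ θ → (a ∈ Z ↔ b ∈ Z)
  arrow : ∀ a b, Arrow Γ σ a b → (a, b) ≠ ((i, [.left]), (i, [])) → (a ∈ Z ↔ b ∈ Z)

/-- The formula with index `i` can be the conclusion of the last rule. -/
def IsRemovable (Γ : Sequent L V ι) (θ : Set (Sym2 (Pos ι))) (σ : V → L.Term V) (i : ι) : Prop :=
  (∃ A B, Γ i = .par A B) ∨ (∃ y A, Γ i = .all y A) ∨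
  (∃ x A, Γ i = .ex x A ∧ ∀ b, ¬ Leap Γ σ (i, []) b) ∨
  ∃ A B, Γ i = .tensor A B ∧ ∃ Z, IsSplitting Γ θ σ i Z

/-- The unswitched edges are the links and the edges into vertices other than pars and universal
quantifiers. Passing to the subtype of vertices discards the addresses that are not vertices of `Γ`;
choices on it extend to those in any way. -/
theorem IsNet.isSwitchingTree [Finite ι] {D : Duality L} {Γ : Sequent L V ι}
    {θ : Set (Sym2 (Pos ι))} {σ : V → L.Term V} (h : IsNet D Γ θ σ) :
    IsSwitchingTree (N := {a // Γ.IsVertex a})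
      (fun a b => s(a.1, b.1) ∈ θ ∨ (Arrow Γ σ a.1 b.1 ∧ ¬ Γ.IsSwitched b.1))
      (fun a b => Arrow Γ σ a.1 b.1) {p | Γ.IsSwitched p.1} := by
  classical
  have hfin : Finite {a // Γ.IsVertex a} := Γ.finite_vertices.to_subtype
  let ext : ({a // Γ.IsVertex a} → {a // Γ.IsVertex a}) → Pos ι → Pos ι :=
    fun c p => if hp : Γ.IsVertex p then (c ⟨p, hp⟩).1 else p
  have hext : ∀ c, IsChoice (fun a b => Arrow Γ σ a.1 b.1)
      {p : {a // Γ.IsVertex a} | Γ.IsSwitched p.1} c → IsArrowChoice Γ σ (ext c) := by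
    intro c hc p hp
    simp only [ext, hp.isVertex, dif_pos]
    exact hc ⟨p, hp.isVertex⟩ hp
  have ext_val : ∀ c (p : {a // Γ.IsVertex a}), ext c p.1 = (c p).1 := fun c p => by
    simp [ext, p.2]
  refine ⟨Set.toFinite _, fun p hp => ?_, fun c hc Z hZ hZ' => ?_, fun c hc p hp => ?_⟩
  · obtain ⟨a, ha⟩ := Sequent.IsSwitched.exists_arrow σ hp
    exact ⟨⟨a, ha.isVertex.1⟩, ha⟩
  · have hmem : ∀ a : {a // Γ.IsVertex a}, a.1 ∈ Subtype.val '' Z ↔ a ∈ Z := fun a =>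
      Subtype.val_injective.mem_set_image
    have := h.correct.conn _ (hext c hc) (Subtype.val '' Z) (fun a b hab => ?_)
      (fun a b hab hcb => ?_)
    · rcases this with h' | h'
      · exact Or.inr (Set.eq_univ_of_forall fun a => (hmem a).1 (h' a.1 a.2))
      · exact Or.inl (Set.eq_empty_of_forall_notMem fun a ha => h' a.1 a.2 ((hmem a).2 ha))
    · obtain ⟨ha, hb⟩ := h.linking.isLeaf hab
      exact (hmem ⟨a, ha.isVertex⟩).trans ((hZ ⟨a, _⟩ ⟨b, _⟩ (Or.inl hab)).trans
        (hmem ⟨b, hb.isVertex⟩).symm)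
    · obtain ⟨ha, hb⟩ := hab.isVertex
      refine (hmem ⟨a, ha⟩).trans (Iff.trans ?_ (hmem ⟨b, hb⟩).symm)
      by_cases hbs : Γ.IsSwitched b
      · have : (⟨a, ha⟩ : {a // Γ.IsVertex a}) = c ⟨b, hb⟩ :=
          Subtype.ext ((hcb hbs).trans (ext_val c ⟨b, hb⟩))
        rw [this]
        exact hZ' ⟨b, hb⟩ hbs
      · exact hZ ⟨a, ha⟩ ⟨b, hb⟩ (Or.inr ⟨hab, hbs⟩)
  · obtain ⟨Z, h1, h2, h3, h4⟩ := h.correct.bridge _ (hext c hc) (c p).1 p.1 (hc p hp)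
      fun _ => (ext_val c p).symm
    refine ⟨Subtype.val ⁻¹' Z, h1, h2, ?_, fun q hq hqp => ?_⟩
    · rintro a b (hab | ⟨hab, hb⟩)
      · exact h3 _ _ hab
      · refine h4 _ _ hab (fun hb' => absurd hb' hb) fun e => hb ?_
        rw [(Prod.mk.inj e).2]
        exact hp
    · refine h4 _ _ (hc q hq) (fun _ => (ext_val c q).symm) fun e => hqp ?_
      exact Subtype.ext (Prod.mk.inj e).2

/-- A bottom set `W` contains a root, and every compound root in it is removable. An atomic root
leads along its link to a second root in `W`; if that one is atomic too, the two atoms form a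
component of every switching and hence the whole sequent. -/
theorem IsNet.exists_removable [Finite ι] {D : Duality L} {Γ : Sequent L V ι}
    {θ : Set (Sym2 (Pos ι))} {σ : V → L.Term V} (h : IsNet D Γ θ σ) :
    (∃ i, IsRemovable Γ θ σ i) ∨
    ∃ (i j : ι) (n : ℕ) (P : L.Relations n) (ts ts' : Fin n → L.Term V), i ≠ j ∧
      (∀ k, k = i ∨ k = j) ∧ Γ i = .atom P ts ∧ Γ j = .atom (D.neg P) ts' ∧
      θ = {s((i, []), (j, []))} := by
  classical
  have hN : Nonempty {a // Γ.IsVertex a} := ⟨⟨(h.nonempty.some, []), Γ.isVertex_root _⟩⟩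
  obtain ⟨W, X, ⟨⟨⟨i, p⟩, hw⟩, hwW⟩, hWU, hWs, hX⟩ := h.isSwitchingTree.exists_bottom
  -- the root of a tree which meets `W` is in `W`
  have hroot : ∀ i p (hv : Γ.IsVertex (i, p)), ⟨(i, p), hv⟩ ∈ W →
      (⟨(i, []), Γ.isVertex_root i⟩ : {a // Γ.IsVertex a}) ∈ W := by
    intro i p
    induction p using List.reverseRecOn with
    | nil => exact fun _ hv => hv
    | append_singleton p d ih =>
      intro hv hvW
      have hv' := Sequent.isVertex_of_append hv
      have har : Arrow Γ σ (i, p ++ [d]) (i, p) := Or.inl ⟨hv, d, rfl⟩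
      -- A child of a switched vertex is a source, so it is not in `W`; the other edges of the
      -- forest do not leave `W`.
      by_cases hs : Γ.IsSwitched (i, p)
      · exact absurd hvW (hWs ⟨(i, p), hv'⟩ hs ⟨_, hv⟩ har)
      · exact ih hv' ((hWU ⟨_, hv⟩ ⟨_, hv'⟩ (Or.inr ⟨har, hs⟩)).1 hvW)
  have at_root : ∀ i, Γ.at? (i, []) = some (Γ i) := fun i => by simp [Sequent.at?, Formula.sub?]
  have main : ∀ i, (⟨(i, []), Γ.isVertex_root i⟩ : {a // Γ.IsVertex a}) ∈ W →
      IsRemovable Γ θ σ i ∨ ∃ (n : ℕ) (P : L.Relations n) (ts : Fin n → L.Term V),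
        Γ i = .atom P ts := by
    intro i hiW
    cases hΓ : Γ i with
    | atom P ts => exact Or.inr ⟨_, P, ts, rfl⟩
    | par A B => exact Or.inl (Or.inl ⟨A, B, hΓ⟩)
    | all y A => exact Or.inl (Or.inr (Or.inl ⟨y, A, hΓ⟩))
    | ex x A =>
      refine Or.inl (Or.inr (Or.inr (Or.inl ⟨x, A, hΓ, fun b hb => ?_⟩)))
      have hb' : Γ.IsSwitched b := by
        obtain ⟨x, A, y, B, -, hb, -⟩ := hb
        exact Or.inr ⟨y, B, hb⟩
      exact hWs ⟨b, hb'.isVertex⟩ hb' ⟨_, Γ.isVertex_root i⟩ (Or.inr hb) hiW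
    | tensor A B =>
      refine Or.inl (Or.inr (Or.inr (Or.inr ⟨A, B, hΓ, ?_⟩)))
      have hl : Γ.IsVertex (i, [.left]) := ⟨A, by simp [Sequent.at?, hΓ, Formula.sub?]⟩
      have har : Arrow Γ σ (i, [.left]) (i, []) := Or.inl ⟨hl, .left, rfl⟩
      have hns : ¬ Γ.IsSwitched (i, []) := by
        simp [Sequent.IsSwitched, at_root, hΓ]
      have hlW := (hWU ⟨_, hl⟩ ⟨_, Γ.isVertex_root i⟩ (Or.inr ⟨har, hns⟩)).2 hiW
      have hch : ∃ c, IsArrowChoice Γ σ c := by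
        have := fun p (hp : Γ.IsSwitched p) => hp.exists_arrow σ
        choose! c hc using this
        exact ⟨c, hc⟩
      obtain ⟨c, hc⟩ := hch
      obtain ⟨Z, h1, h2, h3, h4⟩ := h.correct.bridge c hc _ _ har fun h' => absurd h' hns
      -- `Z` is a cut for the one choice `c` only. Keeping just its trace on `W` and adding all of
      -- `X p` for each switched `p` in that trace makes it a cut for all edges at once.
      let Lf : Set {a // Γ.IsVertex a} :=
        {n | (n ∈ W ∧ n.1 ∈ Z) ∨ ∃ p, Γ.IsSwitched p.1 ∧ p ∈ W ∧ p.1 ∈ Z ∧ n ∈ X p}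
      have hunsw : ∀ a b : {a // Γ.IsVertex a},
          (s(a.1, b.1) ∈ θ ∨ (Arrow Γ σ a.1 b.1 ∧ ¬ Γ.IsSwitched b.1)) →
          (a.1 ∈ Z ↔ b.1 ∈ Z) → (a ∈ Lf ↔ b ∈ Lf) := by
        intro a b hab hab'
        refine or_congr (and_congr (hWU a b hab) hab') (exists_congr fun p =>
          and_congr_right fun hp => and_congr_right fun hpW => and_congr_right fun _ => ?_)
        exact (hX p hp hpW).2.1 a b hab
      have hmem : ∀ a (ha : Γ.IsVertex a), a ∈ Subtype.val '' Lf ↔ ⟨a, ha⟩ ∈ Lf := fun a ha =>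
        Subtype.val_injective.mem_set_image (a := ⟨a, ha⟩)
      refine ⟨Subtype.val '' Lf, (hmem _ hl).2 (Or.inl ⟨hlW, h1⟩), fun hr => ?_,
        fun a b hab => ?_, fun a b hab hne => ?_⟩
      · rcases (hmem _ (Γ.isVertex_root i)).1 hr with hr | ⟨p, hp, hpW, -, hpX⟩
        · exact h2 hr.2
        · exact (hX p hp hpW).1 _ hpX hiW
      · obtain ⟨ha, hb⟩ := h.linking.isLeaf hab
        rw [hmem _ ha.isVertex, hmem _ hb.isVertex]
        exact hunsw _ _ (Or.inl hab) (h3 _ _ hab)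
      · obtain ⟨ha, hb⟩ := hab.isVertex
        rw [hmem _ ha, hmem _ hb]
        by_cases hbs : Γ.IsSwitched b
        · constructor
          · rintro (⟨haW, -⟩ | ⟨p, hp, hpW, hpZ, haX⟩)
            · exact absurd haW (hWs ⟨b, hb⟩ hbs ⟨a, ha⟩ hab)
            · by_cases hbp : ⟨b, hb⟩ = p
              · subst hbp
                exact Or.inl ⟨hpW, hpZ⟩
              · exact Or.inr ⟨p, hp, hpW, hpZ,
                  ((hX p hp hpW).2.2.2 ⟨b, hb⟩ hbs hbp ⟨a, ha⟩ hab).1 haX⟩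
          · rintro (⟨hbW, hbZ⟩ | ⟨p, hp, hpW, hpZ, hbX⟩)
            · exact Or.inr ⟨⟨b, hb⟩, hbs, hbW, hbZ, (hX ⟨b, hb⟩ hbs hbW).2.2.1 ⟨a, ha⟩ hab⟩
            · have hbp : ⟨b, hb⟩ ≠ p := fun e => (hX p hp hpW).1 _ hbX (e ▸ hpW)
              exact Or.inr ⟨p, hp, hpW, hpZ,
                ((hX p hp hpW).2.2.2 ⟨b, hb⟩ hbs hbp ⟨a, ha⟩ hab).2 hbX⟩
        · exact hunsw _ _ (Or.inr ⟨hab, hbs⟩) (h4 a b hab (fun h' => absurd h' hbs) hne)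
  have hiW := hroot i p hw hwW
  rcases main i hiW with hi | ⟨n, P, ts, hi⟩
  · exact Or.inl ⟨i, hi⟩
  have hileaf : Γ.IsLeaf (i, []) := ⟨n, P, ts, (at_root i).trans (congrArg some hi)⟩
  obtain ⟨t, ht, hit⟩ := h.linking.2.2 _ hileaf
  obtain ⟨⟨j, q⟩, rfl⟩ := Sym2.mem_iff_exists.1 hit
  obtain ⟨-, hjl⟩ := h.linking.isLeaf ht
  have hjW := hroot j q hjl.isVertex
    ((hWU ⟨_, hileaf.isVertex⟩ ⟨_, hjl.isVertex⟩ (Or.inl ht)).1 hiW)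
  rcases main j hjW with hj | ⟨m, Q, us, hj⟩
  · exact Or.inl ⟨j, hj⟩
  right
  obtain rfl : q = [] := by
    obtain ⟨_, _, _, hjl⟩ := hjl
    cases q with
    | nil => rfl
    | cons d q => simp [Sequent.at?, hj, Formula.sub?] at hjl
  have hall : ∀ k, k = i ∨ k = j := by
    have hch : ∃ c, IsArrowChoice Γ σ c := by
      have := fun p (hp : Γ.IsSwitched p) => hp.exists_arrow σ
      choose! c hc using this
      exact ⟨c, hc⟩
    obtain ⟨c, hc⟩ := hch
    have hnoar : ∀ a b, Arrow Γ σ a b → ∀ k, (k = i ∨ k = j) → a ≠ (k, []) ∧ b ≠ (k, []) := by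
      intro a b hab k hk
      have hk' : ∃ (n : ℕ) (P : L.Relations n) (ts : Fin n → L.Term V), Γ k = .atom P ts := by
        rcases hk with rfl | rfl
        exacts [⟨_, _, _, hi⟩, ⟨_, _, _, hj⟩]
      obtain ⟨n', P', ts', hk'⟩ := hk'
      rcases hab with ⟨⟨C, hC⟩, d, rfl⟩ | ⟨x, A, y, B, ha, hb, -⟩
      · refine ⟨by simp, ?_⟩
        rintro rfl
        simp [Sequent.at?, hk', Formula.sub?] at hC
      · refine ⟨?_, ?_⟩ <;> rintro rfl
        · simp [at_root, hk'] at ha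
        · simp [at_root, hk'] at hb
    -- Atomic roots have no directed edges, and disjointness of links leaves them only their common
    -- link, so the pair is closed.
    have hlk : ∀ a b, s(a, b) ∈ θ → (a = (i, []) ∨ a = (j, [])) → s(a, b) = s((i, []), (j, [])) := by
      rintro a b hab ha
      exact h.linking.2.1 _ hab _ ht a (by simp) (by simpa using ha)
    have hlk' : ∀ a b, s(a, b) ∈ θ → (a = (i, []) ∨ a = (j, [])) → (b = (i, []) ∨ b = (j, [])) := by
      intro a b hab ha
      have : b ∈ s((i, ([] : List Dir)), (j, [])) := hlk a b hab ha ▸ Sym2.mem_mk_right a b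
      simpa using this
    rcases h.correct.conn c hc {a | a = (i, []) ∨ a = (j, [])}
      (fun a b hab => ⟨hlk' a b hab, hlk' b a (by rwa [Sym2.eq_swap])⟩)
      (fun a b hab _ => by
        have h1 := hnoar a b hab i (Or.inl rfl)
        have h2 := hnoar a b hab j (Or.inr rfl)
        simp [h1, h2]) with h' | h'
    · intro k
      simpa using h' (k, []) (Γ.isVertex_root k)
    · exact absurd (Or.inl rfl) (h' (i, []) (Γ.isVertex_root i))
  have hθ : θ = {s((i, []), (j, []))} := by
    refine Set.eq_singleton_iff_unique_mem.2 ⟨ht, fun s hs => ?_⟩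
    induction s with
    | _ a b =>
    obtain ⟨k, p⟩ := a
    obtain ⟨⟨n', P', ts', ha⟩, -⟩ := h.linking.isLeaf hs
    have hk' : ∃ (n : ℕ) (P : L.Relations n) (ts : Fin n → L.Term V), Γ k = .atom P ts := by
      rcases hall k with rfl | rfl
      exacts [⟨_, _, _, hi⟩, ⟨_, _, _, hj⟩]
    obtain ⟨n', P', ts', hk'⟩ := hk'
    have : p = [] := by
      cases p with
      | nil => rfl
      | cons d p => simp [Sequent.at?, hk', Formula.sub?] at ha
    subst this
    refine h.linking.2.1 _ hs _ ht (k, []) (by simp) ?_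
    rcases hall k with rfl | rfl <;> simp
  obtain ⟨a, b, m', P', ts', us', he, ha, hb⟩ := h.linking.1 _ ht
  -- A link from a leaf to itself would make a predicate symbol its own dual.
  have hne : i ≠ j := by
    rintro rfl
    rcases Sym2.eq_iff.1 he with ⟨rfl, rfl⟩ | ⟨rfl, rfl⟩ <;>
    · rw [ha] at hb
      simp only [Option.some.injEq, Formula.atom.injEq, heq_eq_eq, true_and] at hb
      exact D.neg_ne P' hb.1.symm
  rcases Sym2.eq_iff.1 he with ⟨rfl, rfl⟩ | ⟨rfl, rfl⟩
  · exact ⟨i, j, m', P', ts', us', hne, hall, by simpa [at_root] using ha,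
      by simpa [at_root] using hb, hθ⟩
  · exact ⟨j, i, m', P', ts', us', hne.symm, fun k => (hall k).symm, by simpa [at_root] using ha,
      by simpa [at_root] using hb, by rw [hθ, Sym2.eq_swap]⟩

end Nets

/-! ### Correctness of a unification net in terms of a fixed unifier -/

section Initial

variable {L : FirstOrder.Language.{u, v}} {V : Type w} [DecidableEq V] {ι : Type}

/-- Leaps enter universal quantifiers only, which are switched. Hence every choice among the leaps
of `σ` comes from an actual switching, and it does no harm if the net has further leaps. A tree
gives both conditions: connectedness forbids proper closed sets, and acyclicity makes each edge a
bridge, the cut being a component after its deletion. -/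
theorem isCorrectFor_of_leap {D : Duality L} {Γ : Sequent L V ι} {θ : Set (Sym2 (Pos ι))}
    {σ : V → L.Term V} (hθ : IsUnificationNet D Γ θ)
    (hleap : ∀ a b, Leap Γ σ a b → Precedence Γ θ a b) :
    IsCorrectFor Γ θ σ ∧ Nonempty ι := by
  classical
  have hsw_of_leap : ∀ a b, Precedence Γ θ a b → Γ.IsSwitched b := by
    rintro a b ⟨x, A, y, B, -, -, hb, -⟩
    exact Or.inr ⟨y, B, hb⟩
  have main : ∀ c, IsArrowChoice Γ σ c → ∃ S : Set (Edge ι), IsTreeOn Γ S ∧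
      (∀ s ∈ θ, Edge.link s ∈ S) ∧
      (∀ a b, Arrow Γ σ a b → (Γ.IsSwitched b → a = c b) →
        ∃ e ∈ S, e = .child a b ∨ e = .leap a b) ∧
      ∀ e ∈ S, e.ends ∈ θ ∨
        ∃ a b, Arrow Γ σ a b ∧ (Γ.IsSwitched b → a = c b) ∧ e.ends = s(a, b) := by
    intro c hc
    -- A choice only names the source of an edge. If both a forest edge and a leap start there, the
    -- forest edge is taken.
    let ch : Pos ι → Edge ι := fun p =>
      if Γ.IsVertex (c p) ∧ ∃ d, c p = (p.1, p.2 ++ [d]) then .child (c p) p else .leap (c p) p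
    have ch_cases : ∀ p, ch p = .child (c p) p ∨ ch p = .leap (c p) p := by
      intro p
      by_cases hp : Γ.IsVertex (c p) ∧ ∃ d, c p = (p.1, p.2 ++ [d])
      · exact Or.inl (if_pos hp)
      · exact Or.inr (if_neg hp)
    have ch_into : ∀ p q, (ch p).Into q ↔ p = q := by
      intro p q
      rcases ch_cases p with h | h <;> simp [h, Edge.Into]
    have ch_mem : ∀ p, Γ.IsSwitched p → ch p ∈ graphEdges Γ θ := by
      intro p hp
      by_cases hp' : Γ.IsVertex (c p) ∧ ∃ d, c p = (p.1, p.2 ++ [d])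
      · simp only [ch, if_pos hp']
        exact hp'
      · simp only [ch, if_neg hp']
        exact hleap _ _ ((hc p hp).resolve_left hp')
    let S : Set (Edge ι) := {e | e ∈ graphEdges Γ θ ∧ ∀ p, Γ.IsSwitched p → e.Into p → e = ch p}
    have ch_S : ∀ p, Γ.IsSwitched p → ch p ∈ S := fun p hp =>
      ⟨ch_mem p hp, fun q _ hpq => by rw [(ch_into p q).1 hpq]⟩
    refine ⟨S, hθ.2.2 S ⟨fun e he => he.1, fun e he hn => ⟨he, fun p hp hep => absurd hep (hn p hp)⟩,
      fun p hp => ⟨ch p, ⟨ch_S p hp, (ch_into p p).2 rfl⟩, fun e he => he.1.2 p hp he.2⟩⟩,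
      fun s hs => ⟨hs, fun p _ h => h.elim⟩, fun a b hab hcb => ?_, fun e he => ?_⟩
    · by_cases hb : Γ.IsSwitched b
      · obtain rfl := hcb hb
        exact ⟨ch b, ch_S b hb, ch_cases b⟩
      · rcases hab with hab | hab
        · refine ⟨.child a b, ⟨hab, fun p hp hep => ?_⟩, Or.inl rfl⟩
          obtain rfl : b = p := hep
          exact absurd hp hb
        · exact absurd (hsw_of_leap a b (hleap a b hab)) hb
    · cases e with
      | link s => exact Or.inl he.1
      | child a b =>
        refine Or.inr ⟨a, b, Or.inl he.1, fun hb => ?_, rfl⟩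
        have := he.2 b hb rfl
        rcases ch_cases b with h | h <;> rw [h] at this
        · exact (Edge.child.inj this).1
        · cases this
      | leap a b =>
        have hb := hsw_of_leap a b he.1
        have := he.2 b hb rfl
        have hac : a = c b := by
          rcases ch_cases b with h | h <;> rw [h] at this
          · cases this
          · exact (Edge.leap.inj this).1
        exact Or.inr ⟨a, b, hac ▸ hc b hb, fun _ => hac, rfl⟩
  refine ⟨⟨fun c hc Z hZ hZ' => ?_, fun c hc a b hab hcb => ?_⟩, ?_⟩
  · obtain ⟨S, ⟨-, -, hT⟩, -, -, hS⟩ := main c hc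
    have hadj : ∀ a b, (underlyingGraph Γ S).Adj a b → (a.1 ∈ Z ↔ b.1 ∈ Z) := by
      rintro a b ⟨-, e, he, hends⟩
      rcases hS e he with h | ⟨a', b', h1, h2, h3⟩
      · exact hZ _ _ (hends ▸ h)
      · rcases Sym2.eq_iff.1 (h3.symm.trans hends) with ⟨rfl, rfl⟩ | ⟨rfl, rfl⟩
        · exact hZ' _ _ h1 h2
        · exact (hZ' _ _ h1 h2).symm
    have hreach : ∀ a b, (underlyingGraph Γ S).Reachable a b → (a.1 ∈ Z ↔ b.1 ∈ Z) := by
      rintro a b ⟨w⟩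
      induction w with
      | nil => exact Iff.rfl
      | cons h _ ih => exact (hadj _ _ h).trans ih
    by_cases hex : ∃ a, Γ.IsVertex a ∧ a ∈ Z
    · obtain ⟨a, ha, haZ⟩ := hex
      exact Or.inl fun b hb => (hreach ⟨a, ha⟩ ⟨b, hb⟩ (hT.connected.preconnected _ _)).1 haZ
    · exact Or.inr fun a ha haZ => hex ⟨a, ha, haZ⟩
  · obtain ⟨S, ⟨hdiag, hinj, hT⟩, hlink, harr, -⟩ := main c hc
    obtain ⟨ha, hb⟩ := hab.isVertex
    obtain ⟨e, he, hee⟩ := harr a b hab hcb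
    have hends : e.ends = s(a, b) := by rcases hee with rfl | rfl <;> rfl
    have hne : a ≠ b := by
      have := hdiag e he
      rw [hends] at this
      simpa using this
    have hadj : (underlyingGraph Γ S).Adj ⟨a, ha⟩ ⟨b, hb⟩ := ⟨fun h => hne (congrArg Subtype.val h), e, he, hends⟩
    have hbr := SimpleGraph.isBridge_iff.1
      (SimpleGraph.isAcyclic_iff_forall_adj_isBridge.1 hT.isAcyclic hadj)
    let H := (underlyingGraph Γ S).deleteEdges {s((⟨a, ha⟩ : {n // Γ.IsVertex n}), ⟨b, hb⟩)}
    have hclosed : ∀ e' ∈ S, e' ≠ e → ∀ x y (hx : Γ.IsVertex x) (hy : Γ.IsVertex y),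
        e'.ends = s(x, y) →
        (H.Reachable ⟨a, ha⟩ ⟨x, hx⟩ ↔
          H.Reachable ⟨a, ha⟩ ⟨y, hy⟩) := by
      intro e' he' hne' x y hx hy hxy
      have hxy' : x ≠ y := by
        have := hdiag e' he'
        rw [hxy] at this
        simpa using this
      have hadj' : H.Adj ⟨x, hx⟩ ⟨y, hy⟩ := by
        rw [SimpleGraph.deleteEdges_adj]
        refine ⟨⟨fun h => hxy' (congrArg Subtype.val h), e', he', hxy⟩, fun h => hne' ?_⟩
        -- Having no parallel edges, the switching loses only `e` when the pair `a`, `b` is deleted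
        -- from the simple graph.
        refine hinj he' he ?_
        rw [hxy, hends]
        have h' := congrArg (Sym2.map Subtype.val) (Set.mem_singleton_iff.1 h)
        simpa using h'
      exact ⟨fun h => h.trans hadj'.reachable, fun h => h.trans hadj'.symm.reachable⟩
    let Z : Set (Pos ι) := {n | ∃ hn : Γ.IsVertex n, H.Reachable ⟨a, ha⟩ ⟨n, hn⟩}
    have hZ : ∀ e' ∈ S, e' ≠ e → ∀ x y, Γ.IsVertex x → Γ.IsVertex y → e'.ends = s(x, y) →
        (x ∈ Z ↔ y ∈ Z) := by
      intro e' he' hne' x y hx hy hxy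
      have := hclosed e' he' hne' x y hx hy hxy
      exact ⟨fun ⟨_, h⟩ => ⟨hy, this.1 h⟩, fun ⟨_, h⟩ => ⟨hx, this.2 h⟩⟩
    refine ⟨Z, ⟨ha, SimpleGraph.Reachable.refl _⟩, fun ⟨_, h⟩ => hbr h, fun x y hxy => ?_,
      fun x y hxy hcy hne' => ?_⟩
    · obtain ⟨hx, hy⟩ := hθ.1.isLeaf hxy
      exact hZ (.link s(x, y)) (hlink _ hxy) (by rcases hee with rfl | rfl <;> simp) x y
        hx.isVertex hy.isVertex rfl
    · obtain ⟨hx, hy⟩ := hxy.isVertex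
      obtain ⟨e', he', hee'⟩ := harr x y hxy hcy
      refine hZ e' he' ?_ x y hx hy (by rcases hee' with rfl | rfl <;> rfl)
      rintro rfl
      refine hne' ?_
      rcases hee with rfl | rfl <;> rcases hee' with h | h <;> cases h <;> rfl
  · have hch : ∃ c, IsArrowChoice Γ σ c := by
      have := fun p (hp : Γ.IsSwitched p) => hp.exists_arrow σ
      choose! c hc using this
      exact ⟨c, hc⟩
    obtain ⟨c, hc⟩ := hch
    obtain ⟨S, ⟨-, -, hT⟩, -⟩ := main c hc
    exact ⟨hT.connected.nonempty.some.1.1⟩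

/-- The values of a most general unifier may still contain existential variables. Sending all
variables that are neither free nor universal to one `z` outside the finite set of bound variables
removes them, keeps a unifier and creates no new leap. -/
theorem IsUnificationNet.exists_isNet [Infinite V] [Finite ι] {D : Duality L}
    {Γ : Sequent L V ι} (hΓ : Γ.Clean) {θ : Set (Sym2 (Pos ι))} (hθ : IsUnificationNet D Γ θ) :
    ∃ σ, IsNet D Γ θ σ ∧ ∀ x, Γ.IsFree x → σ x = .var x := by
  classical
  have hbvfin : (⋃ i, (Γ i).bv).Finite := Set.finite_iUnion fun i => (Γ i).finite_bv
  have hbv : ∀ a x, Γ.Quantifies a x → x ∈ ⋃ i, (Γ i).bv := by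
    rintro a x ⟨A, h⟩
    exact Set.mem_iUnion.2 ⟨a.1, Formula.mem_bv_of_sub? h⟩
  have hqex : ∀ a x A, Γ.at? a = some (.ex x A) → Γ.Quantifies a x := fun a x A h => ⟨A, Or.inr h⟩
  have hqall : ∀ a x A, Γ.at? a = some (.all x A) → Γ.Quantifies a x :=
    fun a x A h => ⟨A, Or.inl h⟩
  have hdisj : ∀ a x A b B, Γ.at? a = some (.ex x A) → Γ.at? b = some (.all x B) → False := by
    intro a x A b B ha hb
    obtain rfl := hΓ.1 a b x (hqex a x A ha) (hqall b x B hb)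
    simp [ha] at hb
  obtain ⟨τ, hτ⟩ := hθ.2.1
  let E : Set V := {x | Γ.IsNonvacuousExistential x}
  have hE : E.Finite := hbvfin.subset fun x ⟨a, A, ha, _⟩ => hbv a x (hqex a x A ha)
  let eqs : Set (L.Term V × L.Term V) := {e | ∃ (a b : Pos ι) (n : ℕ) (P P' : L.Relations n)
    (ts ts' : Fin n → L.Term V) (i : Fin n), s(a, b) ∈ θ ∧ Γ.at? a = some (.atom P ts) ∧
      Γ.at? b = some (.atom P' ts') ∧ e = (ts i, ts' i)}
  have hunif : ∀ τ, IsUnifier Γ θ τ ↔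
      (∀ x ∉ E, τ x = .var x) ∧ ∀ e ∈ eqs, e.1.subst τ = e.2.subst τ := by
    intro τ
    refine and_congr Iff.rfl ⟨?_, ?_⟩
    · rintro h _ ⟨a, b, n, P, P', ts, ts', i, h1, h2, h3, rfl⟩
      exact h a b n P P' ts ts' h1 h2 h3 i
    · exact fun h a b n P P' ts ts' h1 h2 h3 i =>
        h _ ⟨a, b, n, P, P', ts, ts', i, h1, h2, h3, rfl⟩
  obtain ⟨hτ1, hτ2⟩ := (hunif τ).1 hτ
  obtain ⟨σ₀, h1, h2, h3⟩ := exists_mgu hE eqs hτ1 hτ2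
  let K : Set V := {y | Γ.IsFree y ∨ Γ.IsUniversal y}
  have hKE : ∀ y ∈ K, ∀ a A, Γ.at? a ≠ some (.ex y A) := by
    rintro y (hy | ⟨b, B, hb⟩) a A ha
    · exact hΓ.2 a y (hqex a y A ha) hy
    · exact hdisj a y A b B ha hb
  have hK : ∀ y ∈ K, y ∉ E := fun y hy ⟨a, A, ha, _⟩ => hKE y hy a A ha
  have hmgu : IsMGU Γ θ σ₀ := by
    refine ⟨(hunif σ₀).2 ⟨h1, h2⟩, fun τ' hτ' => ?_⟩
    obtain ⟨g1, g2⟩ := (hunif τ').1 hτ'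
    -- Every unifier absorbs `σ₀`, so it serves as its own factor, and it fixes the free and
    -- universal variables because these are not unknowns.
    exact ⟨τ', fun y hy => g1 y (hK y hy), fun x _ => h3 τ' g1 g2 x⟩
  obtain ⟨z, hz⟩ := hbvfin.exists_notMem
  let r : V → L.Term V := fun v => if v ∈ K then .var v else .var z
  let σ : V → L.Term V := fun x => (σ₀ x).subst r
  have hσK : ∀ x ∈ K, σ x = .var x := fun x hx => by
    simp [σ, h1 x (hK x hx), Term.subst, r, hx]
  have hmem : ∀ x y, y ∈ (σ x).varFinset → y ∈ ⋃ i, (Γ i).bv → y ∈ K ∧ y ∈ (σ₀ x).varFinset := by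
    intro x y hy hyb
    obtain ⟨v, hv, hyv⟩ := mem_varFinset_subst.1 hy
    by_cases hvK : v ∈ K
    · obtain rfl : y = v := by simpa [r, hvK] using hyv
      exact ⟨hvK, hv⟩
    · obtain rfl : y = z := by simpa [r, hvK] using hyv
      exact absurd hyb hz
  obtain ⟨hcor, hne⟩ := isCorrectFor_of_leap (σ := σ) hθ (by
    rintro a b ⟨x, A, y, B, ha, hb, hy⟩
    have hy0 := (hmem x y hy (hbv b y (hqall b y B hb))).2
    refine ⟨x, A, y, B, ha, ?_, hb, σ₀, hmgu, hy0⟩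
    -- A vacuous `∃ x` is sent to `x` itself by `σ₀`; by cleanness this is not the universal `y`.
    by_contra hxA
    have hxE : x ∉ E := by
      rintro ⟨a', A', ha', hxA'⟩
      obtain rfl := hΓ.1 a a' x (hqex a x A ha) (hqex a' x A' ha')
      rw [ha] at ha'
      cases ha'
      exact hxA hxA'
    rw [h1 x hxE] at hy0
    obtain rfl : y = x := by simpa using hy0
    exact hdisj a y A b B ha hb)
  refine ⟨σ, ⟨hne, hΓ, hθ.1, ?_, ?_, ?_, ?_, hcor⟩, fun x hx => hσK x (Or.inl hx)⟩
  · intro a b n P P' ts ts' hab ha hb i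
    have := hmgu.1.2 a b n P P' ts ts' hab ha hb i
    rw [← subst_subst, ← subst_subst, this]
  · intro x hx a y hay hy
    rw [hσK x (Or.inl hx)] at hy
    obtain rfl : y = x := by simpa using hy
    exact hΓ.2 a y hay hx
  · intro a x A b y B ha hb hy
    exact hKE y (hmem x y hy (hbv b y (hqex b y B hb))).1 b B hb
  · exact fun a y A ha => hσK y (Or.inr ⟨a, A, ha⟩)

end Initial

/-! ### Sequentialization -/

section Sequentialization

variable {L : FirstOrder.Language.{u, v}} {V : Type w}

/-! ### Premises of a rule as embedded forests -/

theorem isForestEmb_reindex {ι κ : Type} {Γ : Sequent L V ι} {Γ' : Sequent L V κ} (e : κ ≃ ι)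
    (h : ∀ k, Γ' k = Γ (e k)) : IsForestEmb Γ' Γ fun a => (e a.1, a.2) where
  inj := fun a b hab => by
    obtain ⟨h1, h2⟩ := Prod.mk.inj hab
    exact Prod.ext (e.injective h1) h2
  at? := fun a => by simp [Sequent.at?, h]
  child := fun _ _ => rfl

theorem IsForestEmb.comp {ι ι' ι'' : Type} {Γ : Sequent L V ι} {Γ' : Sequent L V ι'}
    {Γ'' : Sequent L V ι''} {φ : Pos ι' → Pos ι} {φ' : Pos ι'' → Pos ι'}
    (h : IsForestEmb Γ' Γ φ) (h' : IsForestEmb Γ'' Γ' φ') : IsForestEmb Γ'' Γ (φ ∘ φ') where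
  inj := h.inj.comp h'.inj
  at? := fun a => (h'.at? a).trans (h.at? _)
  child := fun a d => by simp [h'.child, h.child]

theorem isForestEmb_trackPar {ι : Type} (Γ : Sequent L V ι) (A B : Formula L V) :
    IsForestEmb ((Γ.snoc A).snoc B) (Γ.snoc (.par A B)) trackPar where
  inj := by
    rintro ⟨_ | _ | i, p⟩ ⟨_ | _ | j, q⟩ h <;> simp_all [trackPar]
  at? := by
    rintro ⟨_ | _ | i, p⟩ <;> simp [trackPar, Sequent.at?, Sequent.snoc, Formula.sub?]
  child := by
    rintro ⟨_ | _ | i, p⟩ d <;> simp [trackPar]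

theorem isForestEmb_trackQuantifier {ι : Type} (Γ : Sequent L V ι) {A B : Formula L V}
    (h : ∀ p, B.sub? (.body :: p) = A.sub? p) :
    IsForestEmb (Γ.snoc A) (Γ.snoc B) trackQuantifier where
  inj := by
    rintro ⟨_ | i, p⟩ ⟨_ | j, q⟩ h <;> simp_all [trackQuantifier]
  at? := by
    rintro ⟨_ | i, p⟩ <;> simp [trackQuantifier, Sequent.at?, Sequent.snoc, h]
  child := by
    rintro ⟨_ | i, p⟩ d <;> simp [trackQuantifier]

theorem isForestEmb_trackTensorLeft {ι κ : Type} (Γ : Sequent L V ι) (Δ : Sequent L V κ)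
    (A B : Formula L V) : IsForestEmb (Γ.snoc A) (Sequent.snoc (Sum.elim Γ Δ) (.tensor A B))
      (trackTensorLeft κ) where
  inj := by
    rintro ⟨_ | i, p⟩ ⟨_ | j, q⟩ h <;> simp_all [trackTensorLeft]
  at? := by
    rintro ⟨_ | i, p⟩ <;> simp [trackTensorLeft, Sequent.at?, Sequent.snoc, Formula.sub?]
  child := by
    rintro ⟨_ | i, p⟩ d <;> simp [trackTensorLeft]

theorem isForestEmb_trackTensorRight {ι κ : Type} (Γ : Sequent L V ι) (Δ : Sequent L V κ)
    (A B : Formula L V) : IsForestEmb (Δ.snoc B) (Sequent.snoc (Sum.elim Γ Δ) (.tensor A B))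
      (trackTensorRight ι) where
  inj := by
    rintro ⟨_ | i, p⟩ ⟨_ | j, q⟩ h <;> simp_all [trackTensorRight]
  at? := by
    rintro ⟨_ | i, p⟩ <;> simp [trackTensorRight, Sequent.at?, Sequent.snoc, Formula.sub?]
  child := by
    rintro ⟨_ | i, p⟩ d <;> simp [trackTensorRight]

variable [DecidableEq V]

/-- Simultaneous substitution in all formulas of a sequent. -/
def Sequent.msubst {ι : Type} (Γ : Sequent L V ι) (σ : V → L.Term V) : Sequent L V ι :=
  fun i => (Γ i).msubst σ

theorem Sequent.msubst_snoc {ι : Type} (Γ : Sequent L V ι) (A : Formula L V) (σ : V → L.Term V) :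
    (Γ.snoc A).msubst σ = (Γ.msubst σ).snoc (A.msubst σ) := by
  funext i
  cases i <;> rfl

/-- The rules produce sequents of the shape `snoc`. This moves their conclusions to the given index
type, the families being compared only pointwise. -/
theorem CutFreeProof.exists_reindex {D : Duality L} {ι κ : Type} {Γ : Sequent L V ι}
    {Γ' : Sequent L V κ} (e : κ ≃ ι) (h : ∀ k, Γ' k = Γ (e k)) (π : CutFreeProof D Γ') :
    ∃ π' : CutFreeProof D Γ, π'.translate = Sym2.map (fun a => (e a.1, a.2)) '' π.translate := by
  obtain rfl : Γ' = fun k => Γ (e k) := funext h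
  exact ⟨.reindex e π, rfl⟩

theorem image_map_comp {α β γ : Type} (g : β → γ) (f : α → β) (s : Set (Sym2 α)) :
    Sym2.map g '' (Sym2.map f '' s) = Sym2.map (g ∘ f) '' s := by
  rw [Set.image_image]
  simp only [Sym2.map_map]

theorem mem_image_map {α β : Type} {f : α → β} {θ : Set (Sym2 β)} {a b : β} (h : s(a, b) ∈ θ)
    (ha : a ∈ Set.range f) (hb : b ∈ Set.range f) :
    s(a, b) ∈ Sym2.map f '' (Sym2.map f ⁻¹' θ) := by
  obtain ⟨a, rfl⟩ := ha
  obtain ⟨b, rfl⟩ := hb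
  exact ⟨s(a, b), h, rfl⟩

/-- No edge leads from the root of a formula to an unswitched vertex. -/
theorem Arrow.isSwitched_of_root {ι : Type} {Γ : Sequent L V ι} {σ : V → L.Term V} {i : ι}
    {b : Pos ι} (h : Arrow Γ σ (i, []) b) : Γ.IsSwitched b := by
  rcases h with ⟨-, d, hd⟩ | ⟨x, A, y, B, -, hb, -⟩
  · simp at hd
  · exact Or.inr ⟨y, B, hb⟩

/-- Removal of a root with only one edge to keep into it. -/
theorem IsNet.unary {D : Duality L} {ι ι' : Type} {Γ : Sequent L V ι} {Γ' : Sequent L V ι'}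
    {θ : Set (Sym2 (Pos ι))} {σ : V → L.Term V} (h : IsNet D Γ θ σ) {φ : Pos ι' → Pos ι}
    (hφ : IsForestEmb Γ' Γ φ) {i : ι} (hi : (i, []) ∉ Set.range φ)
    (hrange : ∀ b, Γ.IsVertex b → b ≠ (i, []) → b ∈ Set.range φ) (hleaf : ¬ Γ.IsLeaf (i, []))
    (r : Pos ι') (hr : Arrow Γ σ (φ r) (i, []))
    (huniq : ¬ Γ.IsSwitched (i, []) → ∀ a, Arrow Γ σ a (i, []) → a = φ r)
    (hfree : ∀ x, Γ'.IsFree x → Γ.IsFree x ∨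
      (Γ.Quantifies (i, []) x ∧ ∀ b, ¬ Leap Γ σ (i, []) b)) :
    IsNet D Γ' (Sym2.map φ ⁻¹' θ) σ ∧ Sym2.map φ '' (Sym2.map φ ⁻¹' θ) = θ := by
  have hlf : ∀ a, Γ.IsLeaf a → a ∈ Set.range φ := fun a ha =>
    hrange a ha.isVertex fun e => hleaf (e ▸ ha)
  refine ⟨hφ.isNet h r (fun x hx => (hfree x hx).imp_right fun hx => ⟨_, hi, hx⟩)
    (fun a b hab => ?_) (fun a b hab hb => ?_) (fun b hb hbr => ?_), ?_⟩
  · obtain ⟨ha, hb⟩ := h.linking.isLeaf hab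
    exact iff_of_true (hlf a ha) (hlf b hb)
  · by_cases hbi : b = (i, [])
    · subst hbi
      exact Or.inr ⟨huniq hb a hab, hi⟩
    · refine Or.inl (iff_of_true (hrange a hab.isVertex.1 ?_) (hrange b hab.isVertex.2 hbi))
      rintro rfl
      exact hb hab.isSwitched_of_root
  · obtain rfl : b = (i, []) := by
      by_contra hbi
      exact hbr (hrange b hb.isVertex hbi)
    exact ⟨_, hr, Or.inr rfl⟩
  · refine Set.Subset.antisymm (Set.image_preimage_subset _ _) fun s hs => ?_
    induction s with
    | _ a b =>
    obtain ⟨ha, hb⟩ := h.linking.isLeaf hs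
    exact mem_image_map hs (hlf a ha) (hlf b hb)

/-- The two hypotheses of a tensor rule. -/
theorem IsNet.binary {D : Duality L} {ι ι₁ ι₂ : Type} {Γ : Sequent L V ι} {Γ₁ : Sequent L V ι₁}
    {Γ₂ : Sequent L V ι₂} {θ : Set (Sym2 (Pos ι))} {σ : V → L.Term V} (h : IsNet D Γ θ σ)
    {i : ι} {A B : Formula L V} (hi : Γ i = .tensor A B) {Z : Set (Pos ι)}
    (hZ : IsSplitting Γ θ σ i Z) {φ₁ : Pos ι₁ → Pos ι} {φ₂ : Pos ι₂ → Pos ι}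
    (hφ₁ : IsForestEmb Γ₁ Γ φ₁) (hφ₂ : IsForestEmb Γ₂ Γ φ₂)
    (hrange₁ : ∀ b, Γ.IsVertex b → (b ∈ Set.range φ₁ ↔ b ∈ Z))
    (hrange₂ : ∀ b, Γ.IsVertex b → (b ∈ Set.range φ₂ ↔ b ∉ Z ∧ b ≠ (i, [])))
    {r₁ : Pos ι₁} (hr₁ : φ₁ r₁ = (i, [.left])) {r₂ : Pos ι₂} (hr₂ : φ₂ r₂ = (i, [.right]))
    (hfree₁ : ∀ x, Γ₁.IsFree x → Γ.IsFree x) (hfree₂ : ∀ x, Γ₂.IsFree x → Γ.IsFree x) :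
    IsNet D Γ₁ (Sym2.map φ₁ ⁻¹' θ) σ ∧ IsNet D Γ₂ (Sym2.map φ₂ ⁻¹' θ) σ ∧
      Sym2.map φ₁ '' (Sym2.map φ₁ ⁻¹' θ) ∪ Sym2.map φ₂ '' (Sym2.map φ₂ ⁻¹' θ) = θ := by
  have hat : Γ.at? (i, []) = some (.tensor A B) := by simp [Sequent.at?, hi, Formula.sub?]
  have hns : ¬ Γ.IsSwitched (i, []) := by simp [Sequent.IsSwitched, hat]
  have hleaf : ∀ a, Γ.IsLeaf a → a ≠ (i, []) := by
    rintro a ha rfl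
    simp [Sequent.IsLeaf, hat] at ha
  have hne : ∀ {a b}, Γ.IsSwitched b → (a, b) ≠ ((i, [Dir.left]), (i, [])) := by
    rintro a b hb e
    exact hns ((Prod.mk.inj e).2 ▸ hb)
  refine ⟨hφ₁.isNet h r₁ (fun x hx => Or.inl (hfree₁ x hx)) (fun a b hab => ?_)
    (fun a b hab hb => ?_) (fun b hb hbr => ?_), hφ₂.isNet h r₂ (fun x hx => Or.inl (hfree₂ x hx))
    (fun a b hab => ?_) (fun a b hab hb => ?_) (fun b hb hbr => ?_), ?_⟩
  · obtain ⟨ha, hb⟩ := h.linking.isLeaf hab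
    rw [hrange₁ a ha.isVertex, hrange₁ b hb.isVertex, hZ.link a b hab]
  · obtain ⟨ha', hb'⟩ := hab.isVertex
    by_cases he : (a, b) = ((i, [Dir.left]), (i, []))
    · obtain ⟨rfl, rfl⟩ := Prod.mk.inj he
      exact Or.inr ⟨hr₁.symm, fun h' => hZ.root_notMem ((hrange₁ _ hb').1 h')⟩
    · left
      rw [hrange₁ a ha', hrange₁ b hb', hZ.arrow a b hab he]
  · obtain ⟨a, ha⟩ := Sequent.IsSwitched.exists_arrow σ hb
    refine ⟨a, ha, Or.inl ?_⟩
    rwa [hrange₁ a ha.isVertex.1, hZ.arrow a b ha (hne hb), ← hrange₁ b ha.isVertex.2]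
  · obtain ⟨ha, hb⟩ := h.linking.isLeaf hab
    rw [hrange₂ a ha.isVertex, hrange₂ b hb.isVertex, hZ.link a b hab]
    exact and_congr_right fun _ => iff_of_true (hleaf a ha) (hleaf b hb)
  · obtain ⟨ha', hb'⟩ := hab.isVertex
    have har : a ≠ (i, []) := by
      rintro rfl
      exact hb hab.isSwitched_of_root
    by_cases hbi : b = (i, [])
    · subst hbi
      have hb2 : (i, []) ∉ Set.range φ₂ := fun h' => ((hrange₂ _ hb').1 h').2 rfl
      rcases hab with ⟨⟨C, hC⟩, d, rfl⟩ | ⟨x, C, y, E, -, hE, -⟩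
      · cases d with
        | left =>
          exact Or.inl (iff_of_false (fun h' => ((hrange₂ _ ha').1 h').1 hZ.left_mem) hb2)
        | right => exact Or.inr ⟨hr₂.symm, hb2⟩
        | body => simp [Sequent.at?, hi, Formula.sub?] at hC
      · simp [hat] at hE
    · left
      rw [hrange₂ a ha', hrange₂ b hb', hZ.arrow a b hab fun e => hbi (Prod.mk.inj e).2]
      exact and_congr_right fun _ => iff_of_true har hbi
  · obtain ⟨a, ha⟩ := Sequent.IsSwitched.exists_arrow σ hb
    refine ⟨a, ha, Or.inl fun h' => hbr ?_⟩
    rw [hrange₂ a ha.isVertex.1, hZ.arrow a b ha (hne hb)] at h'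
    refine (hrange₂ b ha.isVertex.2).2 ⟨h'.1, ?_⟩
    rintro rfl
    exact hns hb
  · refine Set.Subset.antisymm (Set.union_subset (Set.image_preimage_subset _ _)
      (Set.image_preimage_subset _ _)) fun s hs => ?_
    induction s with
    | _ a b =>
    obtain ⟨ha, hb⟩ := h.linking.isLeaf hs
    by_cases haZ : a ∈ Z
    · exact Or.inl (mem_image_map hs ((hrange₁ a ha.isVertex).2 haZ)
        ((hrange₁ b hb.isVertex).2 ((hZ.link a b hs).1 haZ)))
    · exact Or.inr (mem_image_map hs ((hrange₂ a ha.isVertex).2 ⟨haZ, hleaf a ha⟩)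
        ((hrange₂ b hb.isVertex).2 ⟨fun h' => haZ ((hZ.link a b hs).2 h'), hleaf b hb⟩))

/-- A splitting contains all or nothing of the tree above a vertex other than the tensor. -/
theorem IsSplitting.mem_append_iff {ι : Type} {Γ : Sequent L V ι} {θ : Set (Sym2 (Pos ι))}
    {σ : V → L.Term V} {i : ι} {Z : Set (Pos ι)} (hZ : IsSplitting Γ θ σ i Z) {j : ι}
    {p : List Dir} (hjp : j ≠ i ∨ p ≠ []) (q : List Dir) (hv : Γ.IsVertex (j, p ++ q)) :
    (j, p ++ q) ∈ Z ↔ (j, p) ∈ Z := by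
  induction q using List.reverseRecOn with
  | nil => simp
  | append_singleton q d ih =>
    rw [← List.append_assoc] at hv ⊢
    rw [← ih (Sequent.isVertex_of_append hv)]
    refine hZ.arrow _ _ (Or.inl ⟨hv, d, rfl⟩) fun e => ?_
    rcases hjp with hj | hp
    · exact hj (Prod.mk.inj (Prod.mk.inj e).2).1
    · simp_all

/-- Induction on the number of vertices: a removable root is deleted, and `σ` stays the same in all
premises. -/
theorem IsNet.exists_proof {D : Duality L} {ι : Type} [Finite ι] {Γ : Sequent L V ι}
    {θ : Set (Sym2 (Pos ι))} {σ : V → L.Term V} (h : IsNet D Γ θ σ) :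
    ∃ π : CutFreeProof D (Γ.msubst σ), π.translate = θ := by
  classical
  induction hn : {a | Γ.IsVertex a}.ncard using Nat.strong_induction_on generalizing ι with
  | _ n ih =>
  subst hn
  have at_root : ∀ i, Γ.at? (i, []) = some (Γ i) := fun i => by simp [Sequent.at?, Formula.sub?]
  rcases h.exists_removable with ⟨i, hi⟩ | ⟨i, j, n, P, ts, ts', hij, hall, hi, hj, rfl⟩
  swap
  · let e : Fin 2 ≃ ι := Equiv.ofBijective ![i, j] (by
      constructor
      · intro a b hab
        fin_cases a <;> fin_cases b <;> simp_all
      · intro k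
        rcases hall k with rfl | rfl
        exacts [⟨0, rfl⟩, ⟨1, rfl⟩])
    have hts := h.unif (i, []) (j, []) n P (D.neg P) ts ts' rfl
      ((at_root i).trans (congrArg some hi)) ((at_root j).trans (congrArg some hj))
    obtain ⟨π, hπ⟩ := CutFreeProof.exists_reindex (Γ := Γ.msubst σ) e (fun k => by
      fin_cases k
      · change _ = (Γ i).msubst σ
        rw [hi]
        rfl
      · change _ = (Γ j).msubst σ
        -- The two atoms carry the same terms only after `σ`, since `σ` is a unifier.
        rw [hj, Formula.msubst, ← funext hts]
        rfl) (CutFreeProof.ax (D := D) P fun k => (ts k).subst σ)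
    refine ⟨π, hπ.trans ?_⟩
    simp only [CutFreeProof.translate, Set.image_singleton, Sym2.map_mk]
    rfl
  let e : Option {j // j ≠ i} ≃ ι := Equiv.optionSubtypeNe i
  have e_none : e none = i := Equiv.optionSubtypeNe_none i
  have e_some : ∀ j, e (some j) = j.1 := fun j => Equiv.optionSubtypeNe_some i j
  let Γr : Sequent L V {j // j ≠ i} := fun j => Γ j.1
  have he : ∀ k, Sequent.snoc Γr (Γ i) k = Γ (e k) := by
    rintro (_ | j)
    · rw [e_none]
      rfl
    · rw [e_some]
      rfl
  have range_quantifier : ((∃ y A, Γ i = .all y A) ∨ ∃ x A, Γ i = .ex x A) →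
      (i, []) ∉ Set.range ((fun a : Pos (Option {j // j ≠ i}) => (e a.1, a.2)) ∘
        trackQuantifier) ∧
      ∀ b, Γ.IsVertex b → b ≠ (i, []) →
        b ∈ Set.range ((fun a : Pos (Option {j // j ≠ i}) => (e a.1, a.2)) ∘ trackQuantifier) := by
    intro hq
    constructor
    · rintro ⟨⟨_ | k, p⟩, hk⟩ <;> simp [trackQuantifier, e_some] at hk
      exact k.2 hk.1
    · rintro ⟨j, p⟩ ⟨C, hC⟩ hne
      by_cases hj : j = i
      · subst hj
        cases p with
        | nil => exact absurd rfl hne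
        | cons d p =>
          cases d with
          | body => exact ⟨(none, p), by simp [trackQuantifier, e_none]⟩
          | _ => rcases hq with ⟨y, A, hi⟩ | ⟨y, A, hi⟩ <;>
              simp [Sequent.at?, hi, Formula.sub?] at hC
      · exact ⟨(some ⟨j, hj⟩, p), by simp [trackQuantifier, e_some]⟩
  rcases hi with ⟨A, B, hi⟩ | ⟨y, A, hi⟩ | ⟨x, A, hi, hleap⟩ | ⟨A, B, hi, Z, hZ⟩
  · rw [hi] at he
    have hφ := (isForestEmb_reindex e he).comp (isForestEmb_trackPar Γr A B)
    have hir : (i, []) ∉ Set.range ((fun a : Pos (Option {j // j ≠ i}) => (e a.1, a.2)) ∘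
        trackPar) := by
      rintro ⟨⟨_ | _ | k, p⟩, hk⟩ <;> simp [trackPar, e_some] at hk
      exact k.2 hk.1
    have hrange : ∀ b, Γ.IsVertex b → b ≠ (i, []) →
        b ∈ Set.range ((fun a : Pos (Option {j // j ≠ i}) => (e a.1, a.2)) ∘ trackPar) := by
      rintro ⟨j, p⟩ ⟨C, hC⟩ hne
      by_cases hj : j = i
      · subst hj
        cases p with
        | nil => exact absurd rfl hne
        | cons d p =>
          cases d with
          | left => exact ⟨(some none, p), by simp [trackPar, e_none]⟩
          | right => exact ⟨(none, p), by simp [trackPar, e_none]⟩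
          | body => simp [Sequent.at?, hi, Formula.sub?] at hC
      · exact ⟨(some (some ⟨j, hj⟩), p), by simp [trackPar, e_some]⟩
    have hs : Γ.IsSwitched (i, []) := Or.inl ⟨A, B, by rw [at_root, hi]⟩
    have hfree : ∀ x, ((Γr.snoc A).snoc B).IsFree x → Γ.IsFree x := by
      rintro x ⟨_ | _ | k, hx⟩
      · exact ⟨i, by rw [hi]; exact Or.inr hx⟩
      · exact ⟨i, by rw [hi]; exact Or.inl hx⟩
      · exact ⟨k, hx⟩
    -- The par is hung on its left child; being switched, it keeps only one edge in any case.
    obtain ⟨hnet, hθ⟩ := h.unary hφ hir hrange (by simp [Sequent.IsLeaf, at_root, hi])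
      (some none, []) (Or.inl ⟨⟨A, by simp [trackPar, Sequent.at?, e_none, hi, Formula.sub?]⟩,
        .left, by simp [trackPar, e_none]⟩) (fun h' => absurd hs h') (fun z hz => Or.inl (hfree z hz))
    have hπ := ih _ (hφ.ncard_lt (Γ.isVertex_root i) hir) hnet rfl
    rw [Sequent.msubst_snoc, Sequent.msubst_snoc] at hπ
    obtain ⟨π, hπ⟩ := hπ
    obtain ⟨π', hπ'⟩ := CutFreeProof.exists_reindex (Γ := Γ.msubst σ) e (fun k => by
      rw [Sequent.msubst, ← he k]
      cases k <;> rfl) π.par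
    exact ⟨π', by rw [hπ', CutFreeProof.translate, hπ, image_map_comp, hθ]⟩
  · rw [hi] at he
    have hφ := (isForestEmb_reindex e he).comp
      (isForestEmb_trackQuantifier Γr (A := A) fun p => by simp [Formula.sub?])
    have hs : Γ.at? (i, []) = some (.all y A) := by rw [at_root, hi]
    obtain ⟨hir, hrange⟩ := range_quantifier (Or.inl ⟨y, A, hi⟩)
    have hfree : ∀ x, (Γr.snoc A).IsFree x → Γ.IsFree x ∨
        (Γ.Quantifies (i, []) x ∧ ∀ b, ¬ Leap Γ σ (i, []) b) := by
      rintro x ⟨_ | k, hx⟩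
      · by_cases hxy : x = y
        · subst hxy
          refine Or.inr ⟨⟨A, Or.inl hs⟩, ?_⟩
          rintro b ⟨x, C, z, E, hC, -⟩
          simp [hs] at hC
        · exact Or.inl ⟨i, by rw [hi]; exact ⟨hx, hxy⟩⟩
      · exact Or.inl ⟨k, hx⟩
    obtain ⟨hnet, hθ⟩ := h.unary hφ hir hrange (by simp [Sequent.IsLeaf, at_root, hi])
      (none, []) (Or.inl ⟨⟨A, by simp [trackQuantifier, Sequent.at?, e_none, hi, Formula.sub?]⟩,
        .body, by simp [trackQuantifier, e_none]⟩)
      (fun h' => absurd (Or.inr ⟨y, A, hs⟩) h') hfree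
    have hπ := ih _ (hφ.ncard_lt (Γ.isVertex_root i) hir) hnet rfl
    rw [Sequent.msubst_snoc] at hπ
    obtain ⟨π, hπ⟩ := hπ
    -- The eigenvariable condition: terms assigned to free variables of the net avoid every variable
    -- quantified in it.
    have hy : ¬ (Γr.msubst σ).IsFree y := by
      rintro ⟨k, hk⟩
      obtain ⟨x, hx, hxy⟩ := Formula.exists_of_mem_fv_msubst hk
      exact h.free x ⟨k, hx⟩ _ y ⟨A, Or.inl hs⟩ hxy
    obtain ⟨π', hπ'⟩ := CutFreeProof.exists_reindex (Γ := Γ.msubst σ) e (fun k => by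
      rw [Sequent.msubst, ← he k]
      cases k with
      | none =>
        simp only [Sequent.snoc, Formula.msubst]
        rw [Function.update_eq_self_iff.2 (h.univ _ y A hs).symm]
      | some k => rfl) (CutFreeProof.all y hy π)
    exact ⟨π', by rw [hπ', CutFreeProof.translate, hπ, image_map_comp, hθ]⟩
  · rw [hi] at he
    have hφ := (isForestEmb_reindex e he).comp
      (isForestEmb_trackQuantifier Γr (A := A) fun p => by simp [Formula.sub?])
    have hs : Γ.at? (i, []) = some (.ex x A) := by rw [at_root, hi]
    have hq : Γ.Quantifies (i, []) x := ⟨A, Or.inr hs⟩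
    obtain ⟨hir, hrange⟩ := range_quantifier (Or.inr ⟨x, A, hi⟩)
    have hfree : ∀ z, (Γr.snoc A).IsFree z → Γ.IsFree z ∨
        (Γ.Quantifies (i, []) z ∧ ∀ b, ¬ Leap Γ σ (i, []) b) := by
      rintro z ⟨_ | k, hz⟩
      · by_cases hzx : z = x
        · subst hzx
          exact Or.inr ⟨hq, hleap⟩
        · exact Or.inl ⟨i, by rw [hi]; exact ⟨hz, hzx⟩⟩
      · exact Or.inl ⟨k, hz⟩
    obtain ⟨hnet, hθ⟩ := h.unary hφ hir hrange (by simp [Sequent.IsLeaf, at_root, hi])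
      (none, []) (Or.inl ⟨⟨A, by simp [trackQuantifier, Sequent.at?, e_none, hi, Formula.sub?]⟩,
        .body, by simp [trackQuantifier, e_none]⟩)
      (fun _ a ha => by
        rcases ha with ⟨⟨C, hC⟩, d, rfl⟩ | ⟨z, C, y, E, -, hE, -⟩
        · cases d with
          | body => simp [trackQuantifier, e_none]
          | left => simp [Sequent.at?, hi, Formula.sub?] at hC
          | right => simp [Sequent.at?, hi, Formula.sub?] at hC
        · simp [hs] at hE) hfree
    have hπ := ih _ (hφ.ncard_lt (Γ.isVertex_root i) hir) hnet rfl
    have hA : ∀ y ∈ A.bv, ∃ a, a ≠ (i, []) ∧ Γ.Quantifies a y := by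
      intro y hy
      obtain ⟨p, C, hC⟩ := Formula.exists_sub?_of_mem_bv hy
      exact ⟨(i, .body :: p), by simp, C, by simpa [Sequent.at?, hi, Formula.sub?] using hC⟩
    have hxA : x ∉ A.bv := fun hx => by
      obtain ⟨a, ha, ha'⟩ := hA x hx
      exact ha (h.clean.1 _ _ x ha' hq)
    have hsub := Formula.subst_msubst_update (A := A) (σ := σ) (x := x) (fun v hv hvx =>
      h.free v ⟨i, by rw [hi]; exact ⟨hv, hvx⟩⟩ _ x hq) hxA
    rw [Sequent.msubst_snoc, ← hsub] at hπ
    obtain ⟨π, hπ⟩ := hπ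
    -- A universal quantifier of `A` that captures a variable of `σ x` would receive a leap from the
    -- root; an existential one is excluded by the field `ex`.
    have hff : (A.msubst (Function.update σ x (.var x))).FreeFor x (σ x) := by
      refine Formula.freeFor_of_bv fun y hy hyx => ?_
      rw [Formula.bv_msubst] at hy
      obtain ⟨a, -, C, hC | hC⟩ := hA y hy
      · exact hleap a ⟨x, A, y, C, hs, hC, hyx⟩
      · exact h.ex _ x A a y C hs hC hyx
    obtain ⟨π', hπ'⟩ := CutFreeProof.exists_reindex (Γ := Γ.msubst σ) e (fun k => by
      rw [Sequent.msubst, ← he k]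
      cases k <;> rfl) (CutFreeProof.ex x (σ x) hff π)
    exact ⟨π', by rw [hπ', CutFreeProof.translate, hπ, image_map_comp, hθ]⟩
  · let Γ₁ : Sequent L V {j // j ≠ i ∧ (j, []) ∈ Z} := fun j => Γ j.1
    let Γ₂ : Sequent L V {j // j ≠ i ∧ (j, []) ∉ Z} := fun j => Γ j.1
    -- The other formulas go to the two premises according to the side of their roots.
    let f : Option ({j // j ≠ i ∧ (j, []) ∈ Z} ⊕ {j // j ≠ i ∧ (j, []) ∉ Z}) → ι :=
      fun k => k.elim i (Sum.elim Subtype.val Subtype.val)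
    have hf : Function.Bijective f := by
      constructor
      · rintro (_ | ⟨a, ha, ha'⟩ | ⟨a, ha, ha'⟩) (_ | ⟨b, hb, hb'⟩ | ⟨b, hb, hb'⟩) hab <;>
          simp only [f, Option.elim, Sum.elim_inl, Sum.elim_inr] at hab <;>
          first
          | rfl
          | exact absurd hab ha
          | exact absurd hab.symm hb
          | (subst hab; first | rfl | contradiction)
      · intro j
        by_cases hj : j = i
        · exact ⟨none, hj.symm⟩
        · by_cases hjZ : (j, []) ∈ Z
          · exact ⟨some (.inl ⟨j, hj, hjZ⟩), rfl⟩
          · exact ⟨some (.inr ⟨j, hj, hjZ⟩), rfl⟩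
    let e' := Equiv.ofBijective f hf
    have he' : ∀ k, Sequent.snoc (Sum.elim Γ₁ Γ₂) (.tensor A B) k = Γ (e' k) := by
      rintro (_ | _ | _)
      · exact hi.symm
      · rfl
      · rfl
    have hφ₁ := (isForestEmb_reindex e' he').comp (isForestEmb_trackTensorLeft Γ₁ Γ₂ A B)
    have hφ₂ := (isForestEmb_reindex e' he').comp (isForestEmb_trackTensorRight Γ₁ Γ₂ A B)
    have hright : Γ.IsVertex (i, [.right]) := ⟨B, by simp [Sequent.at?, hi, Formula.sub?]⟩
    have hrightZ : (i, [.right]) ∉ Z := fun h' => hZ.root_notMem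
      ((hZ.arrow _ _ (Or.inl ⟨hright, .right, rfl⟩) (by simp)).1 h')
    -- The only directed edge across the cut is the one from the left argument into the tensor, so
    -- each argument and each other formula lies entirely on one side.
    have hvert : ∀ b, Γ.IsVertex b → b = (i, []) ∨ (∃ p, b = (i, .left :: p) ∧ b ∈ Z) ∨
        (∃ p, b = (i, .right :: p) ∧ b ∉ Z) ∨ ∃ j p, j ≠ i ∧ b = (j, p) ∧ (b ∈ Z ↔ (j, []) ∈ Z) := by
      rintro ⟨j, p⟩ hv
      by_cases hj : j = i
      · subst hj
        rcases p with _ | ⟨_ | _ | _, p⟩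
        · exact Or.inl rfl
        · exact Or.inr (Or.inl ⟨p, rfl,
            (hZ.mem_append_iff (p := [.left]) (Or.inr (by simp)) p hv).2 hZ.left_mem⟩)
        · exact Or.inr (Or.inr (Or.inl ⟨p, rfl, fun h' => hrightZ
            ((hZ.mem_append_iff (p := [.right]) (Or.inr (by simp)) p hv).1 h')⟩))
        · obtain ⟨C, hC⟩ := hv
          simp [Sequent.at?, hi, Formula.sub?] at hC
      · exact Or.inr (Or.inr (Or.inr ⟨j, p, hj, rfl,
          hZ.mem_append_iff (p := []) (Or.inl hj) p hv⟩))
    have hrange₁ : ∀ b, Γ.IsVertex b → (b ∈ Set.range ((fun a : Pos (Option ({j // j ≠ i ∧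
        (j, []) ∈ Z} ⊕ {j // j ≠ i ∧ (j, []) ∉ Z})) => (e' a.1, a.2)) ∘ trackTensorLeft _) ↔
        b ∈ Z) := by
      intro b hb
      constructor
      · rintro ⟨⟨_ | ⟨j, hj, hjZ⟩, p⟩, rfl⟩
        · exact (hZ.mem_append_iff (p := [.left]) (Or.inr (by simp)) p hb).2 hZ.left_mem
        · exact (hZ.mem_append_iff (p := []) (Or.inl hj) p hb).2 hjZ
      · intro hbZ
        rcases hvert b hb with rfl | ⟨p, rfl, -⟩ | ⟨p, rfl, h'⟩ | ⟨j, p, hj, rfl, h'⟩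
        · exact absurd hbZ hZ.root_notMem
        · exact ⟨(none, p), rfl⟩
        · exact absurd hbZ h'
        · exact ⟨(some ⟨j, hj, h'.1 hbZ⟩, p), rfl⟩
    have hrange₂ : ∀ b, Γ.IsVertex b → (b ∈ Set.range ((fun a : Pos (Option ({j // j ≠ i ∧
        (j, []) ∈ Z} ⊕ {j // j ≠ i ∧ (j, []) ∉ Z})) => (e' a.1, a.2)) ∘ trackTensorRight _) ↔
        b ∉ Z ∧ b ≠ (i, [])) := by
      intro b hb
      constructor
      · rintro ⟨⟨_ | ⟨j, hj, hjZ⟩, p⟩, rfl⟩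
        · refine ⟨fun h' => hrightZ
            ((hZ.mem_append_iff (p := [.right]) (Or.inr (by simp)) p hb).1 h'), ?_⟩
          exact fun h' => List.cons_ne_nil _ _ (Prod.mk.inj h').2
        · exact ⟨fun h' => hjZ ((hZ.mem_append_iff (p := []) (Or.inl hj) p hb).1 h'),
            fun h' => hj (Prod.mk.inj h').1⟩
      · rintro ⟨hbZ, hbi⟩
        rcases hvert b hb with rfl | ⟨p, rfl, h'⟩ | ⟨p, rfl, -⟩ | ⟨j, p, hj, rfl, h'⟩
        · exact absurd rfl hbi
        · exact absurd h' hbZ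
        · exact ⟨(none, p), rfl⟩
        · exact ⟨(some ⟨j, hj, fun h'' => hbZ (h'.2 h'')⟩, p), rfl⟩
    have hfree₁ : ∀ x, (Γ₁.snoc A).IsFree x → Γ.IsFree x := by
      rintro x ⟨_ | k, hx⟩
      · exact ⟨i, by rw [hi]; exact Or.inl hx⟩
      · exact ⟨k, hx⟩
    have hfree₂ : ∀ x, (Γ₂.snoc B).IsFree x → Γ.IsFree x := by
      rintro x ⟨_ | k, hx⟩
      · exact ⟨i, by rw [hi]; exact Or.inr hx⟩
      · exact ⟨k, hx⟩
    obtain ⟨hnet₁, hnet₂, hθ⟩ := h.binary hi hZ hφ₁ hφ₂ hrange₁ hrange₂ (r₁ := (none, [])) rfl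
      (r₂ := (none, [])) rfl hfree₁ hfree₂
    have hroot := Γ.isVertex_root i
    have hπ₁ := ih _ (hφ₁.ncard_lt hroot fun h' => hZ.root_notMem ((hrange₁ _ hroot).1 h'))
      hnet₁ rfl
    have hπ₂ := ih _ (hφ₂.ncard_lt hroot fun h' => ((hrange₂ _ hroot).1 h').2 rfl) hnet₂ rfl
    rw [Sequent.msubst_snoc] at hπ₁ hπ₂
    obtain ⟨π₁, hπ₁⟩ := hπ₁
    obtain ⟨π₂, hπ₂⟩ := hπ₂
    obtain ⟨π', hπ'⟩ := CutFreeProof.exists_reindex (Γ := Γ.msubst σ) e' (fun k => by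
      rw [Sequent.msubst, ← he' k]
      rcases k with _ | _ | _ <;> rfl) (π₁.tensor π₂)
    exact ⟨π', by rw [hπ', CutFreeProof.translate, hπ₁, hπ₂, Set.image_union, image_map_comp,
      image_map_comp, hθ]⟩

end Sequentialization

end UNet

theorem mainTheorem2 {L : FirstOrder.Language.{u, v}} {V : Type w} [DecidableEq V] [Infinite V]
    (D : UNet.Duality L) {ι : Type} [Finite ι] (Γ : UNet.Sequent L V ι) (hΓ : Γ.Clean)
    (θ : Set (Sym2 (UNet.Pos ι))) (hθ : UNet.IsUnificationNet D Γ θ) :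
    ∃ π : UNet.CutFreeProof D Γ, π.translate = θ := by
  obtain ⟨σ, hnet, hσ⟩ := hθ.exists_isNet hΓ
  -- The values of `σ` at bound variables do not matter here, since `msubst` acts on free
  -- occurrences only.
  have hself : Γ.msubst σ = Γ := funext fun i => UNet.Formula.msubst_eq_self fun x hx => hσ x ⟨i, hx⟩
  have := hnet.exists_proof
  rwa [hself] at this
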